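/- Let $-1<q<1$ and $\eta,\theta\in\mathbb R$, with $1+\eta\theta>q$ in case $q\ge 0$. Let $(X_t)_{t\ge 0}\sim \mathrm{QH}(\theta,\eta,0,0,q)$ be a bi-Poisson process whose random variables $X_t$ have finite moments of all orders. That is, $X_t$ is square integrable, $\mathbb E X_t=0$, $\mathbb E X_sX_t=s$ for $s<t$, and, with $\mathcal F_{s,u}=\sigma(X_r: r\le s\text{ or } r\ge u)$, for all $0\le s<t<u$, $$\mathbb E(X_t|\mathcal F_{s,u})=\tfrac{u-t}{u-s}X_s+\tfrac{t-s}{u-s}X_u,\qquad \mathrm{Var}(X_t|\mathcal F_{s,u})=\tfrac{(u-t)(t-s)}{u-qs}\Big(1+\theta\Delta+\eta\tilde\Delta-(1-q)\Delta\tilde\Delta\Big),$$ where $\Delta=\frac{X_u-X_s}{u-s}$ and $\tilde\Delta=\frac{uX_s-sX_u}{u-s}$. Put $[n]_q=1+q+\dots+q^{n-1}$. For real $s,t,x$ let $Q_n(y;x,t,s)$ be the monic polynomials in $y$ with $Q_{-1}=0$, $Q_0=1$ and $yQ_n=Q_{n+1}+\mathcal A_nQ_n+\mathcal B_nQ_{n-1}$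 for $n\ge 0$, where $\mathcal A_0=x$, $\mathcal B_0=0$ and, for $n\ge1$, $$\mathcal A_n=q^nx+[n]_q\big(t\eta+\theta-[2]_qq^{n-1}s\eta\big),\qquad \mathcal B_n=[n]_q(t-sq^{n-1})\big\{1+\eta xq^{n-1}+[n-1]_q\,\eta(\theta-s\eta q^{n-1})\big\}.$$ Let $P_{s,t}(x,dy)$ denote the (unique) probability measure with finite moments such that $\int Q_nQ_m\,P_{s,t}(x,dy)=0$ for $m\ne n$, for all those $s,t,x$ for which such a measure exists. **Theorem.** The process $(X_t)$ is a Markov process with transition probabilities $P_{t,u}(x,dy)$, $0\le t<u$: for every measurable $g$ with $g(X_u)$ integrable, $\mathbb E(g(X_u)\,|\,X_r,\,r\le t)=\int g(y)\,P_{t,u}(X_t,dy)$ almost surely. Let $t\ge 0$ and let $x$ be in the support of the law of $X_t$. Then $P_{t,u}(x,dy)$ exists for all $u>t$, the measure $P_{q^2t,t}(q(x-t\eta)+\theta,dy)$ exists if $1+\eta x\neq0$, and, writing $\mathbb E(\,\cdot\,|X_t=x)$ for integration of functions of $X_u$ with respect to $P_{t,u}(x,dy)$: 1. For every real polynomial $f$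 the infinitesimal generator $$A_t(f)(x):=\lim_{u\downarrow t}\frac1{u-t}\,\mathbb E\big(f(X_u)-f(x)\,\big|\,X_t=x\big)$$ exists and $$A_t(f)(x)=(1+\eta x)\int\frac{\partial}{\partial x}\Big(\frac{f(y)-f(x)}{y-x}\Big)\,P_{q^2t,t}\big(q(x-t\eta)+\theta,dy\big),$$ where the difference quotient is extended by continuity to $y=x$ and the right hand side is read as $0$ if $1+\eta x=0$. 2. For every real polynomial $f(x,t)$ in two variables, $$\lim_{u\downarrow t}\frac1{u-t}\,\mathbb E\big(f(X_u,u)-f(x,t)\,\big|\,X_t=x\big)=\frac{\partial}{\partial t}f(x,t)+A_t(f(\cdot,t))(x),$$ where $A_t(f(\cdot,t))(x)$ is given by the formula in 1. -/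

import Mathlib

open MeasureTheory ProbabilityTheory Filter Topology
open scoped NNReal

/-- The sigma-algebra generated by the process up to time `s`. -/
abbrev pastSigma {Ω : Type*} (X : ℝ≥0 → Ω → ℝ) (s : ℝ≥0) : MeasurableSpace Ω :=
  ⨆ (r : ℝ≥0) (_ : r ≤ s), MeasurableSpace.comap (X r) inferInstance

/-- The past-future sigma-algebra `F_{s,u}`, generated by the process up to time `s` and
from time `u` on. -/
abbrev pastFutureSigma {Ω : Type*} (X : ℝ≥0 → Ω → ℝ) (s u : ℝ≥0) : MeasurableSpace Ω :=
  ⨆ (r : ℝ≥0) (_ : r ≤ s ∨ u ≤ r), MeasurableSpace.comap (X r) inferInstance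

/-- The quadratic form `K(x,y)` in the conditional variance of a quadratic harness. -/
def quadraticForm (θ η τ σ q x y : ℝ) : ℝ :=
  1 + θ * x + η * y + τ * x ^ 2 + σ * y ^ 2 - (1 - q) * (x * y)

/-- `X`, indexed by `[0,∞)`, is a standard quadratic harness `QH(θ,η,τ,σ,q)`.
The second argument of `K` in the conditional variance is
`(X_s / s - X_u / u) / (1 / s - 1 / u)`, written as `(u X_s - s X_u) / (u - s)` so that it makes
sense also for `s = 0`. -/
structure IsStandardQuadraticHarness {Ω : Type*} [MeasurableSpace Ω] (θ η τ σ q : ℝ)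
    (P : Measure Ω) (X : ℝ≥0 → Ω → ℝ) : Prop where
  measurable : ∀ t, Measurable (X t)
  memLp_two : ∀ t, MemLp (X t) 2 P
  mean_zero : ∀ t, ∫ ω, X t ω ∂P = 0
  covariance : ∀ s t : ℝ≥0, s < t → ∫ ω, X s ω * X t ω ∂P = s
  harness : ∀ s t u : ℝ≥0, s < t → t < u →
    condExp (pastFutureSigma X s u) P (X t) =ᵐ[P]
      fun ω => ((u : ℝ) - t) / ((u : ℝ) - s) * X s ω + ((t : ℝ) - s) / ((u : ℝ) - s) * X u ω
  variance : ∀ s t u : ℝ≥0, s < t → t < u →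
    condVar (pastFutureSigma X s u) (X t) P =ᵐ[P]
      fun ω => ((u : ℝ) - t) * ((t : ℝ) - s) / ((u : ℝ) * (1 + σ * s) + τ - q * s) *
        quadraticForm θ η τ σ q ((X u ω - X s ω) / ((u : ℝ) - s))
          (((u : ℝ) * X s ω - (s : ℝ) * X u ω) / ((u : ℝ) - s))

/-- The `q`-number `[n]_q = 1 + q + ... + q^(n-1)`. -/
def qNumber (q : ℝ) (n : ℕ) : ℝ := ∑ i ∈ Finset.range n, q ^ i

/-- The diagonal recurrence coefficient
`q^n x + [n](tη + θ - [2] q^(n-1) s η)`. At `n = 0` the truncated exponent is multiplied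
by `[0] = 0`. -/
def biPoissonDiag (q η θ s t x : ℝ) (n : ℕ) : ℝ :=
  q ^ n * x + qNumber q n * (t * η + θ - qNumber q 2 * q ^ (n - 1) * s * η)

/-- The off-diagonal recurrence coefficient
`[n](t - s q^(n-1)) {1 + η x q^(n-1) + [n-1] η (θ - s η q^(n-1))}`. At `n = 0` it is `0`. -/
def biPoissonOffDiag (q η θ s t x : ℝ) (n : ℕ) : ℝ :=
  qNumber q n * (t - s * q ^ (n - 1)) *
    (1 + η * x * q ^ (n - 1) + qNumber q (n - 1) * η * (θ - s * η * q ^ (n - 1)))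

/-- The monic polynomials `Q_n(y;x,t,s)` in the variable `y`, given by the three step recurrence
`y Q_n = Q_(n+1) + A_n Q_n + B_n Q_(n-1)`, `Q_0 = 1`, `Q_(-1) = 0`. -/
noncomputable def biPoissonPoly (q η θ s t x : ℝ) : ℕ → Polynomial ℝ
  | 0 => 1
  | 1 => Polynomial.X - Polynomial.C (biPoissonDiag q η θ s t x 0)
  | n + 2 =>
    (Polynomial.X - Polynomial.C (biPoissonDiag q η θ s t x (n + 1))) *
        biPoissonPoly q η θ s t x (n + 1) -
      Polynomial.C (biPoissonOffDiag q η θ s t x (n + 1)) * biPoissonPoly q η θ s t x n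

/-- `ρ` is a probability measure with finite moments with respect to which the polynomials
`Q_n(y;x,t,s)` are orthogonal. -/
structure IsBiPoissonOrthogonality (q η θ s t x : ℝ) (ρ : Measure ℝ) : Prop where
  isProbabilityMeasure : IsProbabilityMeasure ρ
  integrable_pow : ∀ n : ℕ, Integrable (fun y : ℝ => y ^ n) ρ
  orthogonal : ∀ m n : ℕ, m ≠ n →
    ∫ y, (biPoissonPoly q η θ s t x m).eval y * (biPoissonPoly q η θ s t x n).eval y ∂ρ = 0

open Classical in
/-- The measure `P_{s,t}(x,dy)`: the orthogonality probability measure of the polynomials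
`Q_n(y;x,t,s)`, for all `s`, `t` and all `x` for which it exists, and `0` otherwise.
For `|q| < 1` the recurrence coefficients are bounded in `n`, so there is at most one such
measure. -/
noncomputable def biPoissonTransition (q η θ s t x : ℝ) : Measure ℝ :=
  if h : ∃ ρ : Measure ℝ, IsBiPoissonOrthogonality q η θ s t x ρ then h.choose else 0

/-- The integral operator
`(1 + η x) ∫ ∂/∂x [(g(y) - g(x)) / (y - x)] P_{q² t, t}(q (x - tη) + θ, dy)`.
`dslope g y x` is the difference quotient `(g(y) - g(x)) / (y - x)`, extended by `g'(y)` to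
`x = y`. -/
noncomputable def biPoissonGenerator (q η θ t : ℝ) (g : ℝ → ℝ) (x : ℝ) : ℝ :=
  (1 + η * x) *
    ∫ y, deriv (dslope g y) x ∂(biPoissonTransition q η θ (q ^ 2 * t) t (q * (x - t * η) + θ))

/-! The conditional moments of the process are computed by operators on polynomials. Write X for
multiplication by the variable, and let D satisfy D1 = 0 and DX = qXD + θD + 1 + ηX. Put U_u f = f(X
+ uD)1 and T_{s,u} = U_s⁻¹ U_u. The claim E(f(X_u) | F_s) = (T_{s,u} f)(X_s) is proved by induction
on the degree (`condExp_eval_process`). Conditioning X_t g(X_u) and X_t² g(X_u) on F_{s,u} and on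
F_t yields two relations for the error in the top degree, because T satisfies the same identities
(`transitionOp_harness`, `transitionOp_variance`). The two relations have different factors, so the
error vanishes. In degree one the claim is the martingale property, which follows from the harness
property by letting the later time tend to infinity.

The link to Q_n is that U_u Q_n(·;x,u,s) does not depend on u (`heatEquiv_biPoissonPoly`). Hence
T_{s,u} maps Q_n(·;x,u,s) to Q_n(·;x,s,s), which vanishes at x for n ≥ 1, and f ↦ (T_{s,u} f)(x) is
the orthogonality functional (`eval_transitionOp`). The conditional laws of X_u given F_t are
therefore orthogonality measures almost surely. Bounded recurrence coefficients confine these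
measures to an interval that is locally uniform in the parameters. This gives uniqueness, and a
positivity argument with the moment problem on an interval extends existence to the whole support.

The generator is the derivative of T_{t,u} at u = t. Its commutator with X is U_t⁻¹ D U_t, which is
evaluated on the basis Q_n(·;x,t,t) by the lowering relation `twistedDerivation_martingalePoly` and
the factorization `biPoissonPoly_diag`. The measure P_{q²t,t} exists because the generator is
nonnegative on (y - x)² f(y) with f ≥ 0. -/

namespace BiPoisson

open Polynomial

section algebra

/-! ### Numbers and recurrence coefficients -/

lemma pow_eq_one_sub_qNumber (q : ℝ) (n : ℕ) : q ^ n = 1 - (1 - q) * qNumber q n := by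
  have h := mul_neg_geom_sum q n
  rw [qNumber, h]; ring

@[simp] lemma qNumber_zero (q : ℝ) : qNumber q 0 = 0 := by simp [qNumber]

lemma qNumber_succ (q : ℝ) (n : ℕ) : qNumber q (n + 1) = 1 + q * qNumber q n := by
  rw [qNumber, Finset.sum_range_succ, ← qNumber, pow_eq_one_sub_qNumber]; ring

@[simp] lemma qNumber_one (q : ℝ) : qNumber q 1 = 1 := by simp [qNumber]

lemma qNumber_two (q : ℝ) : qNumber q 2 = 1 + q := by simp [qNumber, Finset.sum_range_succ]

/-- The factor in braces of the off-diagonal recurrence coefficient. -/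
def braceFactor (q η θ s x : ℝ) (n : ℕ) : ℝ :=
  1 + η * x * q ^ (n - 1) + qNumber q (n - 1) * η * (θ - s * η * q ^ (n - 1))

variable (q η θ s t u x : ℝ)

lemma biPoissonOffDiag_eq (n : ℕ) : biPoissonOffDiag q η θ s t x n =
    qNumber q n * (t - s * q ^ (n - 1)) * braceFactor q η θ s x n := rfl

@[simp] lemma biPoissonDiag_zero : biPoissonDiag q η θ s t x 0 = x := by simp [biPoissonDiag]

@[simp] lemma biPoissonOffDiag_zero : biPoissonOffDiag q η θ s t x 0 = 0 := by
  simp [biPoissonOffDiag]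

@[simp] lemma biPoissonPoly_zero : biPoissonPoly q η θ s t x 0 = 1 := by rw [biPoissonPoly]

@[simp] lemma biPoissonPoly_one : biPoissonPoly q η θ s t x 1 = X - C x := by
  rw [biPoissonPoly, biPoissonDiag_zero]

/-- The truncated index n - 1 at n = 0 is harmless, because the off-diagonal coefficient vanishes
there. -/
lemma X_mul_biPoissonPoly (n : ℕ) : X * biPoissonPoly q η θ s t x n =
    biPoissonPoly q η θ s t x (n + 1) +
      biPoissonDiag q η θ s t x n • biPoissonPoly q η θ s t x n +
      biPoissonOffDiag q η θ s t x n • biPoissonPoly q η θ s t x (n - 1) := by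
  cases n with
  | zero => simp [smul_eq_C_mul]
  | succ n => simp only [biPoissonPoly, smul_eq_C_mul, Nat.add_sub_cancel]; ring

lemma biPoissonPoly_add_one (n : ℕ) : biPoissonPoly q η θ s t x (n + 1) =
    X * biPoissonPoly q η θ s t x n -
      biPoissonDiag q η θ s t x n • biPoissonPoly q η θ s t x n -
      biPoissonOffDiag q η θ s t x n • biPoissonPoly q η θ s t x (n - 1) := by
  rw [X_mul_biPoissonPoly]; abel

/-! ### Monic sequences -/

lemma degree_X_mul_add {n : ℕ} {f g : ℝ[X]} (hf : f.Monic ∧ f.natDegree = n)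
    (hg : g.degree ≤ n) : (X * f + g).Monic ∧ (X * f + g).natDegree = n + 1 := by
  have h1 : (X * f).Monic := monic_X.mul hf.1
  have h2 : (X * f).natDegree = n + 1 := by
    rw [natDegree_X_mul hf.1.ne_zero, hf.2]
  have h3 : g.degree < (X * f).degree := by
    rw [degree_eq_natDegree h1.ne_zero, h2]
    exact hg.trans_lt (by exact_mod_cast n.lt_succ_self)
  exact ⟨h1.add_of_left h3, by rw [natDegree_add_eq_left_of_degree_lt h3, h2]⟩

lemma monic_biPoissonPoly (n : ℕ) : (biPoissonPoly q η θ s t x n).Monic ∧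
    (biPoissonPoly q η θ s t x n).natDegree = n := by
  induction n using Nat.strong_induction_on with
  | _ n ih =>
    cases n with
    | zero => simp
    | succ n =>
      rw [biPoissonPoly_add_one, sub_sub, sub_eq_add_neg]
      refine degree_X_mul_add (ih n (by omega)) ?_
      rw [degree_neg]
      refine (degree_add_le _ _).trans (max_le ?_ ?_)
      · refine (degree_smul_le _ _).trans (degree_le_of_natDegree_le (ih n (by omega)).2.le)
      · refine (degree_smul_le _ _).trans (degree_le_of_natDegree_le ?_)
        rw [(ih (n - 1) (by omega)).2]; omega

/-- A family of monic polynomials with `f n` of degree `n`, as a polynomial sequence. -/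
def monicSequence (f : ℕ → ℝ[X]) (hf : ∀ n, (f n).Monic ∧ (f n).natDegree = n) :
    Polynomial.Sequence ℝ where
  elems' := f
  degree_eq' n := by rw [degree_eq_natDegree (hf n).1.ne_zero, (hf n).2]

/-- The basis formed by monic polynomials, one of each degree. -/
noncomputable def monicBasis (f : ℕ → ℝ[X]) (hf : ∀ n, (f n).Monic ∧ (f n).natDegree = n) :
    Module.Basis ℕ ℝ ℝ[X] :=
  (monicSequence f hf).basis fun n => by
    have : (monicSequence f hf n) = f n := rfl
    rw [this, (hf n).1.leadingCoeff]; exact isUnit_one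

@[simp] lemma monicBasis_apply (f : ℕ → ℝ[X]) (hf : ∀ n, (f n).Monic ∧ (f n).natDegree = n)
    (n : ℕ) : monicBasis f hf n = f n := by
  simp [monicBasis]; rfl

/-! ### The twisted derivation -/

/-- The images of the monomials under `twistedDerivation`. -/
noncomputable def twistedDerivationMonomial : ℕ → ℝ[X]
  | 0 => 0
  | n + 1 => (C q * X + C θ) * twistedDerivationMonomial n + (1 + C η * X) * X ^ n

/-- The operator `f ↦ (1 + η x) (f (q x + θ) - f x) / (q x + θ - x)`. -/
noncomputable def twistedDerivation : ℝ[X] →ₗ[ℝ] ℝ[X] :=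
  (basisMonomials ℝ).constr ℝ (twistedDerivationMonomial q η θ)

lemma twistedDerivation_X_pow (n : ℕ) :
    twistedDerivation q η θ (X ^ n) = twistedDerivationMonomial q η θ n := by
  have h := (basisMonomials ℝ).constr_basis ℝ (twistedDerivationMonomial q η θ) n
  simp only [coe_basisMonomials, monomial_one_right_eq_X_pow] at h
  exact h

@[simp] lemma twistedDerivation_one : twistedDerivation q η θ 1 = 0 := by
  simpa [twistedDerivationMonomial] using twistedDerivation_X_pow q η θ 0

/-- Two linear maps on polynomials that agree on the powers of `X` are equal. -/
lemma linearMap_ext_X_pow {M : Type*} [AddCommGroup M] [Module ℝ M] {Φ Ψ : ℝ[X] →ₗ[ℝ] M}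
    (h : ∀ n, Φ (X ^ n) = Ψ (X ^ n)) (f : ℝ[X]) : Φ f = Ψ f := by
  have : Φ = Ψ := (basisMonomials ℝ).ext fun n => by
    simpa only [coe_basisMonomials, monomial_one_right_eq_X_pow] using h n
  rw [this]

/-- This is the commutation rule DX = qXD + θD + 1 + ηX. It encodes the conditional variance of the
harness. -/
lemma twistedDerivation_X_mul (f : ℝ[X]) : twistedDerivation q η θ (X * f) =
    q • (X * twistedDerivation q η θ f) + θ • twistedDerivation q η θ f + f + η • (X * f) := by
  let D := twistedDerivation q η θ
  let m : ℝ[X] →ₗ[ℝ] ℝ[X] := LinearMap.mulLeft ℝ X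
  refine linearMap_ext_X_pow (Φ := D ∘ₗ m)
    (Ψ := q • (m ∘ₗ D) + θ • D + LinearMap.id + η • m) (fun n => ?_) f
  have : X * X ^ n = (X ^ (n + 1) : ℝ[X]) := by ring
  simp only [D, m, LinearMap.comp_apply, LinearMap.mulLeft_apply, LinearMap.add_apply,
    LinearMap.smul_apply, LinearMap.id_apply, this, twistedDerivation_X_pow,
    twistedDerivationMonomial, smul_eq_C_mul]
  ring

lemma degree_twistedDerivationMonomial_le (n : ℕ) :
    (twistedDerivationMonomial q η θ n).degree ≤ n := by
  induction n with
  | zero => simp [twistedDerivationMonomial]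
  | succ n ih =>
    rw [twistedDerivationMonomial]
    have h1 : (C q * X + C θ : ℝ[X]).degree ≤ 1 := degree_linear_le
    have h2 : (1 + C η * X : ℝ[X]).degree ≤ 1 := by
      rw [add_comm]; exact degree_linear_le (b := (1 : ℝ))
    refine (degree_add_le _ _).trans (max_le ?_ ?_)
    · refine (degree_mul_le _ _).trans ((add_le_add h1 ih).trans ?_)
      rw [add_comm]; norm_cast
    · refine (degree_mul_le _ _).trans ((add_le_add h2 (degree_X_pow_le n)).trans ?_)
      rw [add_comm]; norm_cast

/-- A linear map that does not raise degrees on the powers of `X` does not raise degrees. -/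
lemma map_mem_degreeLT {Φ : ℝ[X] →ₗ[ℝ] ℝ[X]} (h : ∀ n : ℕ, (Φ (X ^ n)).degree ≤ n) {n : ℕ}
    {f : ℝ[X]} (hf : f ∈ degreeLT ℝ n) : Φ f ∈ degreeLT ℝ n := by
  classical
  suffices degreeLT ℝ n ≤ (degreeLT ℝ n).comap Φ from this hf
  conv_lhs => rw [degreeLT_eq_span_X_pow]
  rw [Submodule.span_le]
  intro g hg
  simp only [Finset.coe_image, Finset.coe_range, Set.mem_image, Set.mem_Iio] at hg
  obtain ⟨k, hk, rfl⟩ := hg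
  exact mem_degreeLT.2 ((h k).trans_lt (by exact_mod_cast hk))

lemma degree_twistedDerivation_le {f : ℝ[X]} {n : ℕ} (hf : f.degree ≤ n) :
    (twistedDerivation q η θ f).degree ≤ n := by
  have hf' : f ∈ degreeLT ℝ (n + 1) := by rwa [degreeLT_succ_eq_degreeLE, mem_degreeLE]
  have hD := (map_mem_degreeLT (Φ := twistedDerivation q η θ) (fun k => by
    rw [twistedDerivation_X_pow]; exact degree_twistedDerivationMonomial_le q η θ k) hf')
  rw [degreeLT_succ_eq_degreeLE, mem_degreeLE] at hD
  exact hD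

/-! ### The transition operators on polynomials -/

/-- The polynomials `(X + u D) ^ n 1`, where `D` is the twisted derivation. -/
noncomputable def heatPoly (u : ℝ) : ℕ → ℝ[X]
  | 0 => 1
  | n + 1 => X * heatPoly u n + u • twistedDerivation q η θ (heatPoly u n)

lemma monic_heatPoly (n : ℕ) :
    (heatPoly q η θ u n).Monic ∧ (heatPoly q η θ u n).natDegree = n := by
  induction n with
  | zero => simp [heatPoly]
  | succ n ih =>
    rw [heatPoly]
    exact degree_X_mul_add ih ((degree_smul_le _ _).trans
      (degree_twistedDerivation_le q η θ (degree_le_of_natDegree_le ih.2.le)))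

/-- The operator `f ↦ f (X + u D) 1`: the transition operator from time `0` to time `u`. -/
noncomputable def heatEquiv : ℝ[X] ≃ₗ[ℝ] ℝ[X] :=
  (basisMonomials ℝ).equiv (monicBasis (heatPoly q η θ u) (monic_heatPoly q η θ u)) (Equiv.refl ℕ)

lemma heatEquiv_X_pow (n : ℕ) : heatEquiv q η θ u (X ^ n) = heatPoly q η θ u n := by
  have h := (basisMonomials ℝ).equiv_apply n
    (monicBasis (heatPoly q η θ u) (monic_heatPoly q η θ u)) (Equiv.refl ℕ)
  simp only [coe_basisMonomials, monomial_one_right_eq_X_pow, monicBasis_apply,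
    Equiv.refl_apply] at h
  exact h

@[simp] lemma heatEquiv_one : heatEquiv q η θ u 1 = 1 := by
  simpa [heatPoly] using heatEquiv_X_pow q η θ u 0

lemma heatEquiv_X_mul (f : ℝ[X]) : heatEquiv q η θ u (X * f) =
    X * heatEquiv q η θ u f + u • twistedDerivation q η θ (heatEquiv q η θ u f) := by
  let U : ℝ[X] →ₗ[ℝ] ℝ[X] := heatEquiv q η θ u
  let m : ℝ[X] →ₗ[ℝ] ℝ[X] := LinearMap.mulLeft ℝ X
  refine linearMap_ext_X_pow (Φ := U ∘ₗ m)
    (Ψ := m ∘ₗ U + u • (twistedDerivation q η θ ∘ₗ U)) (fun n => ?_) f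
  have : X * X ^ n = (X ^ (n + 1) : ℝ[X]) := by ring
  simp only [U, m, LinearMap.comp_apply, LinearMap.mulLeft_apply, LinearMap.add_apply,
    LinearMap.smul_apply, this, LinearEquiv.coe_coe, heatEquiv_X_pow, heatPoly]

lemma heatEquiv_symm_X_mul (g : ℝ[X]) : (heatEquiv q η θ s).symm (X * g) =
    X * (heatEquiv q η θ s).symm g
      - s • (heatEquiv q η θ s).symm (twistedDerivation q η θ g) := by
  rw [LinearEquiv.symm_apply_eq, map_sub, map_smul, heatEquiv_X_mul]
  simp

/-- The transition operator of the process on polynomials. -/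
noncomputable def transitionOp : ℝ[X] ≃ₗ[ℝ] ℝ[X] :=
  (heatEquiv q η θ u).trans (heatEquiv q η θ s).symm

lemma transitionOp_apply (f : ℝ[X]) :
    transitionOp q η θ s u f = (heatEquiv q η θ s).symm (heatEquiv q η θ u f) := rfl

@[simp] lemma transitionOp_one : transitionOp q η θ s u 1 = 1 := by
  rw [transitionOp_apply, LinearEquiv.symm_apply_eq]; simp

/-- The operator T_{s,t} X T_{t,u} = U_s⁻¹ (X + tD) U_u is affine in t. It equals X T_{s,u} at t = s
and T_{s,u} X at t = u, so it interpolates linearly between them. -/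
lemma transitionOp_harness (f : ℝ[X]) :
    (u - s) • transitionOp q η θ s t (X * transitionOp q η θ t u f) =
      (u - t) • (X * transitionOp q η θ s u f) + (t - s) • transitionOp q η θ s u (X * f) := by
  simp only [transitionOp_apply, heatEquiv_X_mul, LinearEquiv.apply_symm_apply, map_add, map_smul,
    heatEquiv_symm_X_mul]
  match_scalars <;> ring

/-- Every term has the form U_s⁻¹ w U_u with w a word in X and D; the left side comes from w = (X +
tD)². Reordering DX by the commutation rule leaves an identity between scalar coefficients. -/
lemma transitionOp_variance (f : ℝ[X]) :
    ((u - q * s) * (u - s)) • transitionOp q η θ s t (X * (X * transitionOp q η θ t u f)) =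
      ((u - t) * (u - q * t)) • (X * (X * transitionOp q η θ s u f)) +
      ((u - t) * (t - s) * (1 + q)) • (X * transitionOp q η θ s u (X * f)) +
      ((t - s) * (t - q * s)) • transitionOp q η θ s u (X * (X * f)) +
      ((u - t) * (t - s)) • ((u - s) • transitionOp q η θ s u f +
        θ • (transitionOp q η θ s u (X * f) - X * transitionOp q η θ s u f) +
        η • (u • (X * transitionOp q η θ s u f) - s • transitionOp q η θ s u (X * f))) := by
  simp only [transitionOp_apply, heatEquiv_X_mul, LinearEquiv.apply_symm_apply, map_add, map_smul,
    heatEquiv_symm_X_mul, twistedDerivation_X_mul, mul_add, mul_sub, mul_smul_comm]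
  match_scalars <;> ring

/-- Linear maps that fix the powers of `X` up to terms of lower degree. -/
def IsUnipotent (Φ : ℝ[X] →ₗ[ℝ] ℝ[X]) : Prop := ∀ n : ℕ, Φ (X ^ n) - X ^ n ∈ degreeLT ℝ n

lemma IsUnipotent.mem_degreeLT {Φ : ℝ[X] →ₗ[ℝ] ℝ[X]} (h : IsUnipotent Φ) {n : ℕ} {f : ℝ[X]}
    (hf : f ∈ degreeLT ℝ n) : Φ f ∈ degreeLT ℝ n := by
  refine map_mem_degreeLT (fun k => ?_) hf
  have := Polynomial.mem_degreeLT.1 (h k)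
  rw [← sub_add_cancel (Φ (X ^ k)) (X ^ k)]
  exact (degree_add_le _ _).trans (max_le this.le (degree_X_pow_le k))

lemma IsUnipotent.comp {Φ Ψ : ℝ[X] →ₗ[ℝ] ℝ[X]} (h : IsUnipotent Φ) (h' : IsUnipotent Ψ) :
    IsUnipotent (Φ ∘ₗ Ψ) := fun n => by
  have := (degreeLT ℝ n).add_mem (h.mem_degreeLT (h' n)) (h n)
  simpa using this

lemma isUnipotent_heatEquiv : IsUnipotent (heatEquiv q η θ u).toLinearMap := fun n => by
  rw [LinearEquiv.coe_coe, heatEquiv_X_pow, mem_degreeLT]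
  have h := monic_heatPoly q η θ u n
  have hd : (heatPoly q η θ u n).degree = n := by rw [degree_eq_natDegree h.1.ne_zero, h.2]
  rw [← hd]
  refine degree_sub_lt_left (by rw [hd, degree_X_pow]) h.1.ne_zero ?_
  rw [h.1.leadingCoeff, (monic_X_pow n).leadingCoeff]

lemma IsUnipotent.symm {Φ : ℝ[X] ≃ₗ[ℝ] ℝ[X]} (h : IsUnipotent Φ.toLinearMap) :
    IsUnipotent Φ.symm.toLinearMap := fun n => by
  classical
  induction n using Nat.strong_induction_on with
  | _ n ih =>
    have key : degreeLT ℝ n ≤ (degreeLT ℝ n).comap Φ.symm.toLinearMap := by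
      conv_lhs => rw [degreeLT_eq_span_X_pow]
      rw [Submodule.span_le]
      intro g hg
      simp only [Finset.coe_image, Finset.coe_range, Set.mem_image, Set.mem_Iio] at hg
      obtain ⟨k, hk, rfl⟩ := hg
      have h1 := degreeLT_mono hk.le (ih k hk)
      have h2 : (X ^ k : ℝ[X]) ∈ degreeLT ℝ n :=
        Polynomial.mem_degreeLT.2 ((degree_X_pow_le k).trans_lt (by exact_mod_cast hk))
      simpa using (degreeLT ℝ n).add_mem h1 h2
    have := (degreeLT ℝ n).neg_mem (key (h n))
    simpa using this

lemma isUnipotent_transitionOp : IsUnipotent (transitionOp q η θ s u).toLinearMap :=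
  (isUnipotent_heatEquiv q η θ s).symm.comp (isUnipotent_heatEquiv q η θ u)

/-! ### The orthogonal polynomials and the transition operators -/

/-- The image of `Q_n(·; x, s, s)` under the transition operator from time `0` to time `s`. -/
noncomputable def martingalePoly (n : ℕ) : ℝ[X] :=
  heatEquiv q η θ s (biPoissonPoly q η θ s s x n)

lemma X_mul_martingalePoly (n : ℕ) : X * martingalePoly q η θ s x n =
    martingalePoly q η θ s x (n + 1) +
      biPoissonDiag q η θ s s x n • martingalePoly q η θ s x n +
      biPoissonOffDiag q η θ s s x n • martingalePoly q η θ s x (n - 1) -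
      s • twistedDerivation q η θ (martingalePoly q η θ s x n) := by
  have h := congrArg (heatEquiv q η θ s) (X_mul_biPoissonPoly q η θ s s x n)
  rw [heatEquiv_X_mul, map_add, map_add, map_smul, map_smul] at h
  exact eq_sub_of_add_eq h

lemma martingalePoly_zero : martingalePoly q η θ s x 0 = 1 := by simp [martingalePoly]

lemma martingalePoly_one : martingalePoly q η θ s x 1 = X - C x := by
  have h1 : martingalePoly q η θ s x 1 = X * 1 - C x * 1 := by
    have h := X_mul_martingalePoly q η θ s x 0
    simp only [martingalePoly_zero, zero_add, biPoissonDiag_zero, biPoissonOffDiag_zero,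
      twistedDerivation_one, smul_zero, zero_smul, sub_zero, add_zero, smul_eq_C_mul] at h
    rw [h]; ring
  simpa using h1

/-- The scalars [n]η and [n]·brace are the slopes in t of the recurrence coefficients. This is what
makes U_u Q_n(·;x,u,s) independent of u. -/
lemma twistedDerivation_martingalePoly (n : ℕ) :
    twistedDerivation q η θ (martingalePoly q η θ s x n) =
      qNumber q n • (η • martingalePoly q η θ s x n +
        braceFactor q η θ s x n • martingalePoly q η θ s x (n - 1)) := by
  induction n using Nat.twoStepInduction with
  | zero => simp [martingalePoly_zero]
  | one =>
    have h := twistedDerivation_X_mul q η θ 1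
    have hC : (C x : ℝ[X]) = x • 1 := by rw [smul_eq_C_mul, mul_one]
    rw [martingalePoly_one, Nat.sub_self, martingalePoly_zero, map_sub, hC, map_smul, ← mul_one X, h]
    simp only [twistedDerivation_one, qNumber_one, braceFactor]
    simp
    match_scalars <;> ring
  | more n ih0 ih1 =>
    have e1 := X_mul_martingalePoly q η θ s x (n + 1)
    have e0 := X_mul_martingalePoly q η θ s x n
    have eD := congrArg (twistedDerivation q η θ) e1
    have eDD := congrArg (twistedDerivation q η θ) ih1
    have eX := congrArg (fun f => X * f) ih1
    rw [twistedDerivation_X_mul] at eD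
    simp only [map_add, map_sub, map_smul, mul_add, mul_smul_comm, Nat.add_sub_cancel] at *
    set a1 := biPoissonDiag q η θ s s x (n + 1) with ha1
    set b1 := biPoissonOffDiag q η θ s s x (n + 1) with hb1
    set k1 := qNumber q (n + 1) with hk1
    set c1 := braceFactor q η θ s x (n + 1) with hc1
    rw [show n + 2 = n + 1 + 1 from rfl, Nat.add_sub_cancel]
    -- D is applied to the recurrence and D(X M_{n+1}) is expanded by the commutation rule. The
    -- terms X·D M_{n+1} and D² M_{n+1} are reduced by the induction hypotheses and the recurrences.
    linear_combination (norm := skip) (-1 : ℝ) • eD + q • eX + (η + q * k1 * η) • e1 +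
      (q * k1 * c1) • e0 + s • eDD + (θ - a1 + s * k1 * η - s * (η + q * k1 * η)) • ih1 +
      (-b1 + s * k1 * c1 - q * k1 * c1 * s) • ih0
    clear_value a1 b1 k1 c1
    subst ha1 hb1 hk1 hc1
    -- The truncated exponents degenerate at n = 0. Otherwise all powers of q are expressed through
    -- one q-number, which turns the coefficients into polynomial identities.
    cases n with
    | zero =>
      match_scalars <;>
      (try simp only [biPoissonDiag, biPoissonOffDiag, braceFactor, Nat.add_sub_cancel, Nat.zero_add,
        Nat.sub_self, pow_one, pow_zero, qNumber_succ, qNumber_zero]) <;> ring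
    | succ n =>
      match_scalars <;>
      (try simp only [biPoissonDiag, biPoissonOffDiag, braceFactor, Nat.add_sub_cancel,
        pow_succ, pow_eq_one_sub_qNumber q n, qNumber_succ, qNumber_zero]) <;> ring

/-- Replacing s by u as second time parameter changes the recurrence coefficients by (u - s)[n]η and
(u - s)[n]·brace. By the lowering relation this cancels the extra term (u - s) D M_n. -/
lemma heatEquiv_biPoissonPoly (n : ℕ) :
    heatEquiv q η θ u (biPoissonPoly q η θ s u x n) = martingalePoly q η θ s x n := by
  induction n using Nat.strong_induction_on with
  | _ n ih =>
    rcases n with _ | n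
    · simp [martingalePoly]
    · rw [biPoissonPoly_add_one, map_sub, map_sub, heatEquiv_X_mul, map_smul, map_smul,
        ih n (by omega), ih (n - 1) (by omega)]
      have h1 := X_mul_martingalePoly q η θ s x n
      have h2 := twistedDerivation_martingalePoly q η θ s x n
      linear_combination (norm := skip) h1 + (u - s) • h2
      simp only [biPoissonOffDiag_eq, biPoissonDiag]
      match_scalars <;> ring

lemma transitionOp_biPoissonPoly (n : ℕ) :
    transitionOp q η θ s u (biPoissonPoly q η θ s u x n) = biPoissonPoly q η θ s s x n := by
  rw [transitionOp_apply, heatEquiv_biPoissonPoly, LinearEquiv.symm_apply_eq, martingalePoly]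

lemma biPoissonDiag_shift (n : ℕ) :
    biPoissonDiag q η θ (q ^ 2 * t) t (q * (x - t * η) + θ) n =
      biPoissonDiag q η θ t t x (n + 1) := by
  cases n with
  | zero => simp [biPoissonDiag, qNumber_two]; ring
  | succ n =>
    simp only [biPoissonDiag, Nat.add_sub_cancel, pow_succ, pow_eq_one_sub_qNumber q n,
      qNumber_succ, qNumber_zero]
    ring

lemma biPoissonOffDiag_shift (n : ℕ) :
    biPoissonOffDiag q η θ (q ^ 2 * t) t (q * (x - t * η) + θ) (n + 1) =
      biPoissonOffDiag q η θ t t x (n + 2) := by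
  cases n with
  | zero => simp [biPoissonOffDiag, qNumber_two]; ring
  | succ n =>
    simp only [biPoissonOffDiag, Nat.add_sub_cancel, show n + 1 + 2 - 1 = n + 1 + 1 by omega,
      pow_succ, pow_eq_one_sub_qNumber q n, qNumber_succ]
    ring

/-- On the diagonal `s = t` the polynomial `Q_(n+1)` has the root `x`, with the quotient `Q_n` of
shifted parameters. -/
lemma biPoissonPoly_diag (n : ℕ) : biPoissonPoly q η θ t t x (n + 1) =
    (X - C x) * biPoissonPoly q η θ (q ^ 2 * t) t (q * (x - t * η) + θ) n := by
  induction n using Nat.twoStepInduction with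
  | zero => simp
  | one =>
    -- The factor t - s q^(n-1) vanishes at n = 1, s = t, so x splits off as a root.
    have h : biPoissonOffDiag q η θ t t x 1 = 0 := by simp [biPoissonOffDiag]
    have h' := biPoissonDiag_shift q η θ t x 0
    simp only [biPoissonDiag_zero] at h'
    rw [biPoissonPoly_one, h', biPoissonPoly_add_one, h]
    simp only [zero_add, zero_smul, sub_zero, biPoissonPoly_one, smul_eq_C_mul]
    ring
  | more n ih0 ih1 =>
    rw [biPoissonPoly_add_one, biPoissonPoly_add_one _ _ _ (q ^ 2 * t), Nat.add_sub_cancel,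
      show n + 2 - 1 = n + 1 by omega, ih0, ih1, biPoissonDiag_shift, biPoissonOffDiag_shift]
    simp only [smul_eq_C_mul]
    ring

lemma eval_biPoissonPoly_diag (n : ℕ) :
    (biPoissonPoly q η θ t t x n).eval x = if n = 0 then 1 else 0 := by
  rcases n with _ | n
  · simp
  · simp [biPoissonPoly_diag]

/-! ### The orthogonality functional -/

/-- The basis of the polynomials `Q_n(·; x, t, s)`. -/
noncomputable def biPoissonBasis : Module.Basis ℕ ℝ ℝ[X] :=
  monicBasis (biPoissonPoly q η θ s t x) (monic_biPoissonPoly q η θ s t x)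

@[simp] lemma biPoissonBasis_apply (n : ℕ) :
    biPoissonBasis q η θ s t x n = biPoissonPoly q η θ s t x n := monicBasis_apply _ _ n

/-- The functional with `Q_0 ↦ 1` and `Q_n ↦ 0` for `n ≥ 1`. -/
noncomputable def biPoissonFunctional : ℝ[X] →ₗ[ℝ] ℝ := (biPoissonBasis q η θ s t x).coord 0

lemma biPoissonFunctional_biPoissonPoly (n : ℕ) :
    biPoissonFunctional q η θ s t x (biPoissonPoly q η θ s t x n) = if n = 0 then 1 else 0 := by
  rw [biPoissonFunctional, ← biPoissonBasis_apply, Module.Basis.coord_apply, Module.Basis.repr_self,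
    Finsupp.single_apply]

@[simp] lemma biPoissonFunctional_one : biPoissonFunctional q η θ s t x 1 = 1 := by
  simpa using biPoissonFunctional_biPoissonPoly q η θ s t x 0

variable {q η θ s t x} in
lemma eq_biPoissonFunctional {L : ℝ[X] →ₗ[ℝ] ℝ}
    (h : ∀ n, L (biPoissonPoly q η θ s t x n) = if n = 0 then 1 else 0) :
    L = biPoissonFunctional q η θ s t x :=
  (biPoissonBasis q η θ s t x).ext fun n => by
    rw [biPoissonBasis_apply, h, biPoissonFunctional_biPoissonPoly]

/-- T_{s,t} sends Q_n(·;x,t,s) to Q_n(·;x,s,s), whose value at x is 0 for n ≥ 1. In particular the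
functional is polynomial in x, which is used for limits in x. -/
lemma eval_transitionOp (f : ℝ[X]) :
    (transitionOp q η θ s t f).eval x = biPoissonFunctional q η θ s t x f := by
  have : leval x ∘ₗ (transitionOp q η θ s t).toLinearMap = biPoissonFunctional q η θ s t x :=
    eq_biPoissonFunctional fun n => by
      simp [transitionOp_biPoissonPoly, eval_biPoissonPoly_diag]
  simpa using LinearMap.congr_fun this f

lemma biPoissonFunctional_mul_X_pow (k n : ℕ) (h : k < n) :
    biPoissonFunctional q η θ s t x (X ^ k * biPoissonPoly q η θ s t x n) = 0 := by
  induction k generalizing n with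
  | zero => simp [biPoissonFunctional_biPoissonPoly, h.ne']
  | succ k ih =>
    rw [pow_succ, mul_assoc, X_mul_biPoissonPoly]
    simp only [mul_add, mul_smul_comm, map_add, map_smul]
    rw [ih _ (by omega), ih _ (by omega), ih _ (by omega)]
    simp

lemma biPoissonFunctional_orthogonal {m n : ℕ} (h : m ≠ n) :
    biPoissonFunctional q η θ s t x
      (biPoissonPoly q η θ s t x m * biPoissonPoly q η θ s t x n) = 0 := by
  wlog hmn : m < n generalizing m n
  · rw [mul_comm]; exact this h.symm (by omega)
  rw [(biPoissonPoly q η θ s t x m).as_sum_range_C_mul_X_pow, Finset.sum_mul, map_sum]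
  refine Finset.sum_eq_zero fun k hk => ?_
  rw [(monic_biPoissonPoly q η θ s t x m).2, Finset.mem_range] at hk
  rw [← smul_eq_C_mul, smul_mul_assoc, map_smul,
    biPoissonFunctional_mul_X_pow q η θ s t x k n (by omega), smul_zero]

lemma biPoissonFunctional_sq :
    biPoissonFunctional q η θ s t x ((X - C x) ^ 2) = (t - s) * (1 + η * x) := by
  have h : (X - C x : ℝ[X]) ^ 2 = X * biPoissonPoly q η θ s t x 1 -
      x • biPoissonPoly q η θ s t x 1 := by
    rw [biPoissonPoly_one, smul_eq_C_mul]; ring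
  rw [h, X_mul_biPoissonPoly]
  simp only [map_add, map_sub, map_smul, biPoissonFunctional_biPoissonPoly]
  simp [biPoissonOffDiag]

/-! ### Bounds -/

section bounds

variable {q} (hq : -1 < q) (hq' : q < 1)
include hq hq'

lemma abs_qNumber_le (n : ℕ) : |qNumber q n| ≤ 2 / (1 - q) := by
  have h1 : (1 - q) * qNumber q n = 1 - q ^ n := by rw [pow_eq_one_sub_qNumber q n]; ring
  have h2 : |q ^ n| ≤ 1 := by
    rw [abs_pow]; exact pow_le_one₀ (abs_nonneg q) (abs_lt.2 ⟨hq, hq'⟩).le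
  have h3 : 0 < 1 - q := by linarith
  have h4 : (1 - q) * |qNumber q n| = |1 - q ^ n| := by rw [← h1, abs_mul, abs_of_pos h3]
  rw [le_div_iff₀ h3, mul_comm, h4]
  rw [abs_le] at *
  constructor <;> linarith

lemma abs_pow_le_one (n : ℕ) : |q ^ n| ≤ 1 := by
  rw [abs_pow]; exact pow_le_one₀ (abs_nonneg q) (abs_lt.2 ⟨hq, hq'⟩).le

lemma abs_biPoissonDiag_le {b : ℝ} (hs : |s| ≤ b) (ht : |t| ≤ b) (hx : |x| ≤ b) (n : ℕ) :
    |biPoissonDiag q η θ s t x n| ≤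
      1 * b + 2 / (1 - q) * (b * |η| + |θ| + 2 * 1 * b * |η|) := by
  have h0 : 0 ≤ b := (abs_nonneg s).trans hs
  have h1 := abs_pow_le_one hq hq' n
  have h2 := abs_pow_le_one hq hq' (n - 1)
  have h3 := abs_qNumber_le hq hq' n
  have h4 : |qNumber q 2| ≤ 2 := by rw [qNumber_two, abs_le]; constructor <;> linarith
  have h5 : 0 ≤ 2 / (1 - q) := (abs_nonneg _).trans h3
  rw [biPoissonDiag]
  refine (abs_add_le _ _).trans (add_le_add ?_ ?_)
  · rw [abs_mul]; gcongr
  · rw [abs_mul]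
    gcongr
    refine (abs_sub _ _).trans (add_le_add ((abs_add_le _ _).trans ?_) ?_)
    · rw [abs_mul]; gcongr
    · simp only [abs_mul]; gcongr

lemma abs_biPoissonOffDiag_le {b : ℝ} (hs : |s| ≤ b) (ht : |t| ≤ b) (hx : |x| ≤ b) (n : ℕ) :
    |biPoissonOffDiag q η θ s t x n| ≤ 2 / (1 - q) * (b + b * 1) *
      (1 + |η| * b * 1 + 2 / (1 - q) * |η| * (|θ| + b * |η| * 1)) := by
  have h0 : 0 ≤ b := (abs_nonneg s).trans hs
  have h2 := abs_pow_le_one hq hq' (n - 1)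
  have h3 := abs_qNumber_le hq hq' n
  have h4 := abs_qNumber_le hq hq' (n - 1)
  have h5 : 0 ≤ 2 / (1 - q) := (abs_nonneg _).trans h3
  rw [biPoissonOffDiag, abs_mul, abs_mul]
  gcongr
  · refine (abs_sub _ _).trans ?_
    rw [abs_mul]; gcongr
  · refine (abs_add_le _ _).trans (add_le_add ((abs_add_le _ _).trans ?_) ?_)
    · simp only [abs_mul, abs_one]; gcongr
    · simp only [abs_mul]
      gcongr
      refine (abs_sub _ _).trans ?_
      simp only [abs_mul]; gcongr

/-- Locally uniform exponential bounds for the moments. -/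
lemma exists_biPoissonFunctional_bound (b : ℝ) : ∃ R : ℝ, 0 ≤ R ∧ ∀ s t x : ℝ, |s| ≤ b → |t| ≤ b →
    |x| ≤ b → ∀ n, |biPoissonFunctional q η θ s t x (X ^ n)| ≤ R ^ n := by
  refine ⟨1 + |1 * b + 2 / (1 - q) * (b * |η| + |θ| + 2 * 1 * b * |η|)| +
    |2 / (1 - q) * (b + b * 1) * (1 + |η| * b * 1 + 2 / (1 - q) * |η| * (|θ| + b * |η| * 1))|,
    by positivity, fun s t x hs ht hx n => ?_⟩
  set a := |1 * b + 2 / (1 - q) * (b * |η| + |θ| + 2 * 1 * b * |η|)|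
  set d := |2 / (1 - q) * (b + b * 1) *
    (1 + |η| * b * 1 + 2 / (1 - q) * |η| * (|θ| + b * |η| * 1))|
  -- The induction treats all k at once: multiplication by X passes from index k to k + 1, k, k - 1
  -- with weights at most 1, a, d.
  have key : ∀ n k : ℕ, |biPoissonFunctional q η θ s t x (X ^ n * biPoissonPoly q η θ s t x k)| ≤
      (1 + a + d) ^ n := by
    intro n
    induction n with
    | zero =>
      intro k
      rw [pow_zero, one_mul, biPoissonFunctional_biPoissonPoly, pow_zero]
      split_ifs <;> simp
    | succ n ih =>
      intro k
      have ha : |biPoissonDiag q η θ s t x k| ≤ a :=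
        (abs_biPoissonDiag_le η θ s t x hq hq' hs ht hx k).trans (le_abs_self _)
      have hd : |biPoissonOffDiag q η θ s t x k| ≤ d :=
        (abs_biPoissonOffDiag_le η θ s t x hq hq' hs ht hx k).trans (le_abs_self _)
      rw [pow_succ, mul_assoc, X_mul_biPoissonPoly]
      simp only [mul_add, mul_smul_comm, map_add, map_smul, smul_eq_mul]
      refine (abs_add_le _ _).trans ((add_le_add_left (abs_add_le _ _) _).trans ?_)
      rw [abs_mul, abs_mul, pow_succ]
      have h1 := ih (k + 1)
      have h2 := mul_le_mul ha (ih k) (abs_nonneg _) (abs_nonneg _)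
      have h3 := mul_le_mul hd (ih (k - 1)) (abs_nonneg _) (abs_nonneg _)
      linarith
  simpa using key n 0

end bounds

/-! ### Divided differences -/

lemma X_sub_C_mul_divByMonic (f : ℝ[X]) :
    (X - C x) * (f /ₘ (X - C x)) = f - C (f.eval x) := by
  rw [X_sub_C_mul_divByMonic_eq_sub_modByMonic, modByMonic_X_sub_C_eq_C_eval]

/-- The difference quotient `f ↦ (f - f x) / (X - x)`. -/
noncomputable def divDiff : ℝ[X] →ₗ[ℝ] ℝ[X] where
  toFun f := f /ₘ (X - C x)
  map_add' f g := by
    apply mul_left_cancel₀ (X_sub_C_ne_zero x)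
    simp only [mul_add, X_sub_C_mul_divByMonic, eval_add, C_add]
    ring
  map_smul' c f := by
    apply mul_left_cancel₀ (X_sub_C_ne_zero x)
    rw [RingHom.id_apply, mul_smul_comm, X_sub_C_mul_divByMonic, X_sub_C_mul_divByMonic, eval_smul,
      smul_eq_mul, C_mul, smul_sub, smul_eq_C_mul, smul_eq_C_mul]

lemma X_sub_C_mul_divDiff (f : ℝ[X]) : (X - C x) * divDiff x f = f - C (f.eval x) :=
  X_sub_C_mul_divByMonic x f

lemma divDiff_eq_of_mul {f g : ℝ[X]} (h : (X - C x) * g = f - C (f.eval x)) :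
    divDiff x f = g :=
  mul_left_cancel₀ (X_sub_C_ne_zero x) (by rw [h, X_sub_C_mul_divDiff])

lemma divDiff_X_sub_C_mul (f : ℝ[X]) : divDiff x ((X - C x) * f) = f :=
  divDiff_eq_of_mul x (by simp)

lemma divDiff_X_mul (f : ℝ[X]) : divDiff x (X * f) = f + x • divDiff x f := by
  apply divDiff_eq_of_mul
  rw [mul_add, mul_smul_comm, X_sub_C_mul_divDiff, smul_eq_C_mul, eval_mul, eval_X, C_mul]
  ring

@[simp] lemma divDiff_one : divDiff x 1 = 0 := divDiff_eq_of_mul x (by simp)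

lemma eval_divDiff_self (f : ℝ[X]) : (divDiff x f).eval x = (derivative f).eval x := by
  have h := congrArg (fun g => (derivative g).eval x) (X_sub_C_mul_divDiff x f)
  simpa using h

lemma sub_mul_eval_divDiff (f : ℝ[X]) (y : ℝ) :
    (y - x) * (divDiff x f).eval y = f.eval y - f.eval x := by
  have h := congrArg (fun g => g.eval y) (X_sub_C_mul_divDiff x f)
  simpa using h

lemma dslope_eval (f : ℝ[X]) (y : ℝ) :
    dslope (fun z => f.eval z) y = fun z => (divDiff y f).eval z := by
  funext z
  rcases eq_or_ne z y with rfl | hz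
  · rw [dslope_same, eval_divDiff_self, Polynomial.deriv]
  · rw [dslope_of_ne _ hz, slope_def_field, div_eq_iff (sub_ne_zero.2 hz), mul_comm,
      sub_mul_eval_divDiff]

/-- Divided differences are symmetric, so both sides are the second divided difference of f at the
nodes x, x, y. -/
lemma deriv_dslope_eval (f : ℝ[X]) (y : ℝ) :
    deriv (dslope (fun z => f.eval z) y) x = (divDiff x (divDiff x f)).eval y := by
  rw [dslope_eval, Polynomial.deriv]
  rcases eq_or_ne y x with rfl | hy
  · rw [eval_divDiff_self]
  · have h1 := sub_mul_eval_divDiff y f x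
    have h2 := sub_mul_eval_divDiff x f y
    have h3 := sub_mul_eval_divDiff x (divDiff x f) y
    have h4 := congrArg (fun g => (derivative g).eval x) (X_sub_C_mul_divDiff y f)
    simp at h4
    rw [eval_divDiff_self] at h3
    have hyx := sub_ne_zero.2 hy
    have h5 : (divDiff y f).eval x = (divDiff x f).eval y :=
      mul_left_cancel₀ hyx (by linarith)
    refine mul_left_cancel₀ hyx ?_
    rw [h3]; linarith

/-! ### The generator on polynomials -/

section generator

/-- The commutator of the generator with the multiplication by `X`. -/
noncomputable def generatorCommutator (f : ℝ[X]) : ℝ[X] :=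
  (heatEquiv q η θ t).symm (twistedDerivation q η θ (heatEquiv q η θ t f))

/-- It suffices to test on Q_n(·;x,t,t). The left side follows from the lowering relation, the right
side from dividing out the root x; only n = 1 contributes, with value 1 + ηx. -/
lemma eval_generatorCommutator (f : ℝ[X]) : (generatorCommutator q η θ t f).eval x =
    (1 + η * x) * biPoissonFunctional q η θ (q ^ 2 * t) t (q * (x - t * η) + θ)
      (divDiff x f) := by
  let Φ : ℝ[X] →ₗ[ℝ] ℝ := leval x ∘ₗ (heatEquiv q η θ t).symm.toLinearMap ∘ₗ
    twistedDerivation q η θ ∘ₗ (heatEquiv q η θ t).toLinearMap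
  let Ψ : ℝ[X] →ₗ[ℝ] ℝ := (1 + η * x) •
    (biPoissonFunctional q η θ (q ^ 2 * t) t (q * (x - t * η) + θ) ∘ₗ divDiff x)
  suffices Φ = Ψ from LinearMap.congr_fun this f
  refine (biPoissonBasis q η θ t t x).ext fun n => ?_
  simp only [Φ, Ψ, biPoissonBasis_apply, LinearMap.comp_apply, LinearEquiv.coe_coe,
    LinearMap.smul_apply, leval_apply]
  rw [← martingalePoly, twistedDerivation_martingalePoly, martingalePoly, martingalePoly]
  simp only [map_smul, map_add, LinearEquiv.symm_apply_apply, eval_smul, eval_add,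
    eval_biPoissonPoly_diag, smul_eq_mul]
  rcases n with _ | n
  · simp
  · rw [biPoissonPoly_diag, divDiff_X_sub_C_mul, biPoissonFunctional_biPoissonPoly]
    rcases n with _ | n <;> simp [braceFactor]

/-- The generator at time `t`, applied to polynomials and evaluated at `x`. -/
noncomputable def generatorFunctional : ℝ[X] →ₗ[ℝ] ℝ :=
  (1 + η * x) • (biPoissonFunctional q η θ (q ^ 2 * t) t (q * (x - t * η) + θ) ∘ₗ
    divDiff x ∘ₗ divDiff x)

lemma generatorFunctional_apply (f : ℝ[X]) : generatorFunctional q η θ t x f =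
    (1 + η * x) * biPoissonFunctional q η θ (q ^ 2 * t) t (q * (x - t * η) + θ)
      (divDiff x (divDiff x f)) := rfl

lemma generatorFunctional_X_mul (f : ℝ[X]) : generatorFunctional q η θ t x (X * f) =
    x * generatorFunctional q η θ t x f + (generatorCommutator q η θ t f).eval x := by
  rw [eval_generatorCommutator, generatorFunctional_apply, generatorFunctional_apply, divDiff_X_mul]
  simp only [map_add, map_smul, smul_eq_mul]
  ring

/-- Quantifying over L lets the induction absorb X and D into the functional. -/
lemma differentiable_heatPoly (L : ℝ[X] →ₗ[ℝ] ℝ) (n : ℕ) :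
    Differentiable ℝ fun u => L (heatPoly q η θ u n) := by
  induction n generalizing L with
  | zero => simp [heatPoly]
  | succ n ih =>
    simp only [heatPoly, map_add, map_smul, smul_eq_mul]
    exact (ih (L ∘ₗ LinearMap.mulLeft ℝ X)).add
      (differentiable_id.mul (ih (L ∘ₗ twistedDerivation q η θ)))

lemma transitionOp_X_mul (f : ℝ[X]) : transitionOp q η θ t u (X * f) =
    X * transitionOp q η θ t u f +
      (u - t) • (heatEquiv q η θ t).symm (twistedDerivation q η θ (heatEquiv q η θ u f)) := by
  rw [transitionOp_apply, heatEquiv_X_mul, map_add, heatEquiv_symm_X_mul, map_smul, transitionOp_apply]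
  module

lemma transitionOp_self (f : ℝ[X]) : transitionOp q η θ t t f = f := by
  simp [transitionOp_apply]

lemma hasDerivAt_transitionOp_X_pow (n : ℕ) :
    HasDerivAt (fun u => (transitionOp q η θ t u (X ^ n)).eval x)
      (generatorFunctional q η θ t x (X ^ n)) t := by
  induction n with
  | zero =>
    simp only [pow_zero, transitionOp_one, eval_one, generatorFunctional_apply, divDiff_one, map_zero,
      mul_zero]
    exact hasDerivAt_const _ _
  | succ n ih =>
    have h1 : (X : ℝ[X]) ^ (n + 1) = X * X ^ n := by ring
    rw [h1, generatorFunctional_X_mul]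
    simp only [transitionOp_X_mul, eval_add, eval_mul, eval_X, eval_smul, smul_eq_mul]
    have h2 := (differentiable_heatPoly q η θ (leval x ∘ₗ (heatEquiv q η θ t).symm.toLinearMap ∘ₗ
      twistedDerivation q η θ) n t).hasDerivAt
    -- The derivative of (u - t) h(u) at u = t is h(t), here the commutator term.
    have h3 := (ih.const_mul x).add (((hasDerivAt_id t).sub_const t).mul h2)
    simp only [LinearMap.comp_apply, LinearEquiv.coe_coe, leval_apply, ← heatEquiv_X_pow, id, sub_self,
      zero_mul, add_zero, one_mul] at h3
    exact h3

lemma hasDerivAt_transitionOp (f : ℝ[X]) :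
    HasDerivAt (fun u => (transitionOp q η θ t u f).eval x)
      (generatorFunctional q η θ t x f) t := by
  induction f using Polynomial.induction_on' with
  | add f g hf hg => simpa only [map_add, eval_add] using hf.fun_add hg
  | monomial n a =>
    have : monomial n a = a • (X ^ n : ℝ[X]) := by rw [smul_eq_C_mul, C_mul_X_pow_eq_monomial]
    rw [this]
    simp only [map_smul, eval_smul, smul_eq_mul]
    exact (hasDerivAt_transitionOp_X_pow q η θ t x n).const_mul a

/-- The polynomial `f(·, u)`. -/
noncomputable def slice (u : ℝ) : MvPolynomial (Fin 2) ℝ →ₐ[ℝ] ℝ[X] :=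
  MvPolynomial.aeval ![X, C u]

lemma eval_slice (f : MvPolynomial (Fin 2) ℝ) (y : ℝ) :
    (slice u f).eval y = MvPolynomial.eval ![y, u] f := by
  induction f using MvPolynomial.induction_on with
  | C a => simp [slice]
  | add f g hf hg => simp [hf, hg]
  | mul_X f i hf => fin_cases i <;> simp [hf] <;> simp [slice]

lemma hasDerivAt_transitionOp_slice (f : MvPolynomial (Fin 2) ℝ) :
    HasDerivAt (fun u => (transitionOp q η θ t u (slice u f)).eval x)
      (deriv (fun r => MvPolynomial.eval ![x, r] f) t +
        generatorFunctional q η θ t x (slice t f)) t := by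
  suffices ∃ d, HasDerivAt (fun r => MvPolynomial.eval ![x, r] f) d t ∧
      HasDerivAt (fun u => (transitionOp q η θ t u (slice u f)).eval x)
        (d + generatorFunctional q η θ t x (slice t f)) t by
    obtain ⟨d, h1, h2⟩ := this
    rwa [h1.deriv]
  induction f using MvPolynomial.induction_on' with
  | add f g hf hg =>
    obtain ⟨d, h1, h2⟩ := hf
    obtain ⟨e, h3, h4⟩ := hg
    refine ⟨d + e, by simpa only [map_add] using h1.fun_add h3, ?_⟩
    simp only [map_add, eval_add]
    rw [add_add_add_comm]
    exact h2.fun_add h4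
  | monomial s a =>
    have hs : ∀ r, slice r (MvPolynomial.monomial s a) = (a * r ^ s 1) • X ^ s 0 := fun r => by
      rw [slice, MvPolynomial.aeval_monomial]
      simp [Finsupp.prod_fintype, smul_eq_C_mul]
      ring
    have h1 : HasDerivAt (fun r : ℝ => a * r ^ s 1) (a * (s 1 * t ^ (s 1 - 1))) t :=
      (hasDerivAt_pow (s 1) t).const_mul a
    refine ⟨a * (s 1 * t ^ (s 1 - 1)) * x ^ s 0, ?_, ?_⟩
    · simp only [← eval_slice, hs, eval_smul, eval_pow, eval_X, smul_eq_mul]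
      exact h1.mul_const _
    · simp only [hs, map_smul, eval_smul, smul_eq_mul]
      have h2 := h1.fun_mul (hasDerivAt_transitionOp_X_pow q η θ t x (s 0))
      simpa only [transitionOp_self, eval_pow, eval_X] using h2

end generator

end algebra

/-! ### The moment problem on an interval -/

section moments

open scoped CompactlySupported

lemma integrable_eval {μ : Measure ℝ} (h : ∀ n : ℕ, Integrable (fun y : ℝ => y ^ n) μ) (f : ℝ[X]) :
    Integrable (fun y => f.eval y) μ := by
  simp only [eval_eq_sum_range]
  exact integrable_finsetSum _ fun i _ => (h i).const_mul _

/-- The integral as a linear functional on polynomials. -/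
noncomputable def integralFunctional (μ : Measure ℝ)
    (h : ∀ n : ℕ, Integrable (fun y : ℝ => y ^ n) μ) : ℝ[X] →ₗ[ℝ] ℝ where
  toFun f := ∫ y, f.eval y ∂μ
  map_add' f g := by
    simp only [eval_add]; exact integral_add (integrable_eval h f) (integrable_eval h g)
  map_smul' c f := by
    simp only [eval_smul, smul_eq_mul, RingHom.id_apply]; exact integral_const_mul _ _

lemma integrable_of_measure_compl_eq_zero {μ : Measure ℝ} [IsFiniteMeasure μ] {R : ℝ}
    (h : μ (Set.Icc (-R) R)ᶜ = 0) {f : ℝ → ℝ} (hf : Continuous f) : Integrable f μ := by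
  have h1 : IntegrableOn f (Set.Icc (-R) R) μ := hf.continuousOn.integrableOn_compact isCompact_Icc
  rw [← Measure.restrict_eq_self_of_ae_mem (s := Set.Icc (-R) R) (μ := μ)]
  · exact h1
  · exact mem_ae_iff.2 h

/-- **Hausdorff moment problem**: a functional on polynomials that is nonnegative on polynomials that
are nonnegative on an interval is represented by a measure on this interval. -/
theorem exists_measure_of_nonneg (L : ℝ[X] →ₗ[ℝ] ℝ) (R : ℝ)
    (hL : ∀ f : ℝ[X], (∀ y ∈ Set.Icc (-R) R, 0 ≤ f.eval y) → 0 ≤ L f) :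
    ∃ μ : Measure ℝ, IsFiniteMeasure μ ∧ μ (Set.Icc (-R) R)ᶜ = 0 ∧
      ∀ f : ℝ[X], ∫ y, f.eval y ∂μ = L f := by
  let I := Set.Icc (-R) R
  -- The cone consists of pairs whose sum is nonnegative on I. L lives on the first factor; its
  -- positive extension restricts to a positive functional on C_c(I), to which the Riesz
  -- representation theorem applies.
  let s : PointedCone ℝ (ℝ[X] × C_c(I, ℝ)) :=
    { carrier := {p | ∀ y : I, 0 ≤ p.1.eval (y : ℝ) + p.2 y}
      add_mem' := fun {p p'} h h' y => by
        have := add_nonneg (h y) (h' y)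
        simp only [Prod.fst_add, Prod.snd_add, eval_add, CompactlySupportedContinuousMap.add_apply]
        linarith
      zero_mem' := fun y => by simp
      smul_mem' := fun c p h y => by
        have := mul_nonneg c.2 (h y)
        have h1 : (c • p).1 = (c : ℝ) • p.1 := rfl
        have h2 : (c • p).2 y = (c : ℝ) * p.2 y := rfl
        rw [h1, h2, eval_smul, smul_eq_mul, ← mul_add]
        exact this }
  have hs : ∀ p, p ∈ s ↔ ∀ y : I, 0 ≤ p.1.eval (y : ℝ) + p.2 y := fun p => Iff.rfl
  let F : (ℝ[X] × C_c(I, ℝ)) →ₗ.[ℝ] ℝ :=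
    ⟨Submodule.prod ⊤ ⊥, L ∘ₗ LinearMap.fst ℝ _ _ ∘ₗ Submodule.subtype _⟩
  obtain ⟨g, hg, hgs⟩ := riesz_extension s F (by
    rintro ⟨⟨p, f⟩, hp⟩ h
    have hf : f = 0 := by simpa [F] using hp
    subst hf
    exact hL p fun y hy => by simpa using (hs _).1 h ⟨y, hy⟩) (by
    rintro ⟨p, f⟩
    obtain ⟨c, hc⟩ := isCompact_univ.exists_bound_of_continuousOn (f := f)
      (map_continuous f).continuousOn
    refine ⟨⟨(C c - p, 0), by simp [F]⟩, (hs _).2 fun y => ?_⟩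
    have := hc y (Set.mem_univ y)
    rw [Real.norm_eq_abs, abs_le] at this
    simp
    linarith)
  let Λ : C_c(I, ℝ) →ₚ[ℝ] ℝ := PositiveLinearMap.mk₀ (g ∘ₗ LinearMap.inr ℝ _ _) fun f hf =>
    hgs _ ((hs _).2 fun y => by simpa using hf y)
  have hemb : MeasurableEmbedding (Subtype.val : I → ℝ) :=
    MeasurableEmbedding.subtype_coe measurableSet_Icc
  refine ⟨(RealRMK.rieszMeasure Λ).map Subtype.val, inferInstance, ?_, fun p => ?_⟩
  · rw [hemb.map_apply]
    convert measure_empty (μ := RealRMK.rieszMeasure Λ)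
    ext y
    simp
  · rw [hemb.integral_map]
    let f : C_c(I, ℝ) := CompactlySupportedContinuousMap.continuousMapEquiv (p.toContinuousMapOn I)
    have h1 : ∫ y, f y ∂(RealRMK.rieszMeasure Λ) = g (0, f) := RealRMK.integral_rieszMeasure Λ f
    have hf : ∀ y, f y = p.eval (y : ℝ) := fun y => rfl
    have h2 : g (p, 0) = L p := hg ⟨(p, 0), by simp [F]⟩
    -- Both (p, -f) and (-p, f) have sum zero on I and so lie in the cone. This forces g(p, 0) =
    -- g(0, f).
    have h3 : 0 ≤ g (p, -f) := hgs _ ((hs _).2 fun y => by simp [hf])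
    have h4 : 0 ≤ g (-p, f) := hgs _ ((hs _).2 fun y => by simp [hf])
    have h5 : g (p, -f) = g (p, 0) - g (0, f) := by rw [← map_sub]; simp
    have h6 : g (-p, f) = g (0, f) - g (p, 0) := by rw [← map_sub]; simp
    simp only [hf] at h1
    rw [h1]; linarith

/-- A measure on a bounded interval is determined by its moments. -/
theorem eq_of_integral_eval_eq {μ ν : Measure ℝ} [IsFiniteMeasure μ] [IsFiniteMeasure ν] {R : ℝ}
    (hμ : μ (Set.Icc (-R) R)ᶜ = 0) (hν : ν (Set.Icc (-R) R)ᶜ = 0)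
    (h : ∀ f : ℝ[X], ∫ y, f.eval y ∂μ = ∫ y, f.eval y ∂ν) : μ = ν := by
  refine ext_of_forall_integral_eq_of_IsFiniteMeasure fun f => ?_
  have key : ∀ (ξ : Measure ℝ) [IsFiniteMeasure ξ], ξ (Set.Icc (-R) R)ᶜ = 0 → ∀ (p : ℝ[X]) (ε : ℝ),
      (∀ y ∈ Set.Icc (-R) R, |p.eval y - f y| < ε) →
      |∫ y, p.eval y ∂ξ - ∫ y, f y ∂ξ| ≤ ε * ξ.real Set.univ := by
    intro ξ _ hξ p ε hp
    rw [← integral_sub (integrable_of_measure_compl_eq_zero hξ p.continuous)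
      (integrable_of_measure_compl_eq_zero hξ f.continuous), ← Real.norm_eq_abs]
    refine norm_integral_le_of_norm_le_const ?_
    filter_upwards [mem_ae_iff.2 hξ] with y hy using (hp y hy).le
  refine eq_of_forall_dist_le fun ε hε => ?_
  set K := μ.real Set.univ + ν.real Set.univ + 1
  have hK : 0 < K := by positivity
  obtain ⟨p, hp⟩ := exists_polynomial_near_of_continuousOn (-R) R f f.continuous.continuousOn
    (ε / K) (by positivity)
  have h1 := key μ hμ p _ hp
  have h2 := key ν hν p _ hp
  have h3 : ε / K * μ.real Set.univ + ε / K * ν.real Set.univ ≤ ε := by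
    rw [← mul_add]
    calc ε / K * (μ.real Set.univ + ν.real Set.univ) ≤ ε / K * K := by
          gcongr; simp [K]
      _ = ε := by field_simp
  rw [h p] at h1
  rw [Real.dist_eq]
  rw [abs_le] at *
  constructor <;> linarith [h1.1, h1.2, h2.1, h2.2]

/-- A measure with exponentially bounded moments lives on a bounded interval. -/
theorem measure_compl_Icc_eq_zero {μ : Measure ℝ} [IsFiniteMeasure μ]
    (hμ : ∀ n : ℕ, Integrable (fun y : ℝ => y ^ n) μ) {R : ℝ} (hR : 0 ≤ R)
    (h : ∀ n : ℕ, |∫ y, y ^ n ∂μ| ≤ R ^ n) : μ (Set.Icc (-R) R)ᶜ = 0 := by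
  have key : ∀ r, R < r → μ {y | r ≤ |y|} = 0 := by
    intro r hr
    have hr0 : 0 < r := hR.trans_lt hr
    -- Markov's inequality for y^(2n); the bound tends to 0 because R < r.
    have h1 : ∀ n : ℕ, μ.real {y | r ≤ |y|} ≤ ((R / r) ^ 2) ^ n := by
      intro n
      have h2 := mul_meas_ge_le_integral_of_nonneg (μ := μ) (f := fun y : ℝ => y ^ (2 * n))
        (Eventually.of_forall fun y => by simp only [pow_mul]; positivity) (hμ _) (r ^ (2 * n))
      have h3 : μ.real {y : ℝ | r ≤ |y|} ≤ μ.real {y : ℝ | r ^ (2 * n) ≤ y ^ (2 * n)} := by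
        refine measureReal_mono fun y (hy : r ≤ |y|) => ?_
        have : y ^ (2 * n) = |y| ^ (2 * n) := by rw [pow_mul, pow_mul, sq_abs]
        rw [Set.mem_ofPred_eq, this]
        gcongr
      have h4 := (h2.trans (le_abs_self _)).trans (h _)
      rw [← pow_mul, div_pow, le_div_iff₀ (by positivity), mul_comm]
      exact (mul_le_mul_of_nonneg_left h3 (by positivity)).trans h4
    have h5 : Tendsto (fun n : ℕ => ((R / r) ^ 2) ^ n) atTop (𝓝 0) := by
      refine tendsto_pow_atTop_nhds_zero_of_lt_one (by positivity) ?_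
      rw [sq_lt_one_iff₀ (by positivity), div_lt_one hr0]
      exact hr
    have h6 : μ.real {y | r ≤ |y|} ≤ 0 := ge_of_tendsto' h5 h1
    exact (measureReal_eq_zero_iff).1 (le_antisymm h6 measureReal_nonneg)
  have h1 : (Set.Icc (-R) R)ᶜ ⊆ ⋃ k : ℕ, {y : ℝ | R + 1 / ((k : ℝ) + 1) ≤ |y|} := by
    intro y hy
    have : R < |y| := by
      rw [Set.mem_compl_iff, Set.mem_Icc, ← abs_le] at hy; exact not_le.1 hy
    obtain ⟨k, hk⟩ := exists_nat_one_div_lt (sub_pos.2 this)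
    exact Set.mem_iUnion.2 ⟨k, by rw [Set.mem_ofPred_eq]; linarith⟩
  refine measure_mono_null h1 (measure_iUnion_null fun k => key _ ?_)
  have : 0 < 1 / ((k : ℝ) + 1) := by positivity
  linarith

end moments

/-! ### Orthogonality measures -/

section orthogonality

variable {q η θ s t x : ℝ} {ρ : Measure ℝ}

lemma integral_eval_of_isBiPoissonOrthogonality (h : IsBiPoissonOrthogonality q η θ s t x ρ)
    (f : ℝ[X]) : ∫ y, f.eval y ∂ρ = biPoissonFunctional q η θ s t x f := by
  have := h.isProbabilityMeasure
  have h1 : integralFunctional ρ h.integrable_pow = biPoissonFunctional q η θ s t x :=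
    eq_biPoissonFunctional fun n => by
      rcases n with _ | n
      · simp [integralFunctional]
      · have h2 := h.orthogonal 0 (n + 1) (by omega)
        simp only [biPoissonPoly_zero, eval_one, one_mul] at h2
        simpa [integralFunctional] using h2
  exact LinearMap.congr_fun h1 f

lemma isBiPoissonOrthogonality_of_integral [IsProbabilityMeasure ρ]
    (h : ∀ n : ℕ, Integrable (fun y : ℝ => y ^ n) ρ)
    (h' : ∀ f : ℝ[X], ∫ y, f.eval y ∂ρ = biPoissonFunctional q η θ s t x f) :
    IsBiPoissonOrthogonality q η θ s t x ρ where
  isProbabilityMeasure := inferInstance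
  integrable_pow := h
  orthogonal m n hmn := by
    simp only [← eval_mul]
    rw [h', biPoissonFunctional_orthogonal _ _ _ _ _ _ hmn]

lemma isBiPoissonOrthogonality_measure_compl (h : IsBiPoissonOrthogonality q η θ s t x ρ) {R : ℝ}
    (hR : 0 ≤ R) (hb : ∀ n, |biPoissonFunctional q η θ s t x (X ^ n)| ≤ R ^ n) :
    ρ (Set.Icc (-R) R)ᶜ = 0 := by
  have := h.isProbabilityMeasure
  refine measure_compl_Icc_eq_zero h.integrable_pow hR fun n => ?_
  have h1 := integral_eval_of_isBiPoissonOrthogonality h (X ^ n)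
  simp only [eval_pow, eval_X] at h1
  rw [h1]; exact hb n

lemma biPoissonFunctional_nonneg (h : IsBiPoissonOrthogonality q η θ s t x ρ) {R : ℝ}
    (hR : 0 ≤ R) (hb : ∀ n, |biPoissonFunctional q η θ s t x (X ^ n)| ≤ R ^ n) {f : ℝ[X]}
    (hf : ∀ y ∈ Set.Icc (-R) R, 0 ≤ f.eval y) : 0 ≤ biPoissonFunctional q η θ s t x f := by
  rw [← integral_eval_of_isBiPoissonOrthogonality h]
  refine integral_nonneg_of_ae ?_
  filter_upwards [mem_ae_iff.2 (isBiPoissonOrthogonality_measure_compl h hR hb)] with y hy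
    using hf y hy

lemma exists_isBiPoissonOrthogonality (R : ℝ)
    (h : ∀ f : ℝ[X], (∀ y ∈ Set.Icc (-R) R, 0 ≤ f.eval y) → 0 ≤ biPoissonFunctional q η θ s t x f) :
    ∃ ρ, IsBiPoissonOrthogonality q η θ s t x ρ := by
  obtain ⟨ρ, _, h1, h2⟩ := exists_measure_of_nonneg _ R h
  have : IsProbabilityMeasure ρ := by
    have h3 := h2 1
    simp only [eval_one, integral_const, smul_eq_mul, mul_one, biPoissonFunctional_one] at h3
    exact ⟨by rw [← ENNReal.toReal_eq_one_iff]; exact h3⟩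
  exact ⟨ρ, isBiPoissonOrthogonality_of_integral
    (fun n => integrable_of_measure_compl_eq_zero h1 (continuous_pow n)) h2⟩

lemma isBiPoissonOrthogonality_biPoissonTransition
    (h : ∃ ρ, IsBiPoissonOrthogonality q η θ s t x ρ) :
    IsBiPoissonOrthogonality q η θ s t x (biPoissonTransition q η θ s t x) := by
  rw [biPoissonTransition, dif_pos h]; exact h.choose_spec

/-- Exponentially bounded moments put both measures on one bounded interval, where moments determine
a measure. -/
lemma eq_biPoissonTransition (hq : -1 < q) (hq' : q < 1)
    (h : IsBiPoissonOrthogonality q η θ s t x ρ) : ρ = biPoissonTransition q η θ s t x := by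
  have h' := isBiPoissonOrthogonality_biPoissonTransition ⟨ρ, h⟩
  have := h.isProbabilityMeasure
  have := h'.isProbabilityMeasure
  obtain ⟨R, hR, hb⟩ := exists_biPoissonFunctional_bound η θ hq hq' (max |s| (max |t| |x|))
  have hb' := hb s t x (le_max_left _ _) ((le_max_left _ _).trans (le_max_right _ _))
    ((le_max_right _ _).trans (le_max_right _ _))
  refine eq_of_integral_eval_eq (isBiPoissonOrthogonality_measure_compl h hR hb')
    (isBiPoissonOrthogonality_measure_compl h' hR hb') fun f => ?_
  rw [integral_eval_of_isBiPoissonOrthogonality h, integral_eval_of_isBiPoissonOrthogonality h']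

/-- The set of points at which the transition measures exist is closed. -/
lemma exists_isBiPoissonOrthogonality_of_mem_closure (hq : -1 < q) (hq' : q < 1)
    (hx : x ∈ closure {z | ∃ ρ, IsBiPoissonOrthogonality q η θ s t z ρ}) :
    ∃ ρ, IsBiPoissonOrthogonality q η θ s t x ρ := by
  -- The margin |x| + 1 gives one interval for all nearby z. For fixed f the functional is
  -- continuous in z, so its nonnegativity passes to the limit.
  obtain ⟨R, hR, hb⟩ := exists_biPoissonFunctional_bound η θ hq hq' (max |s| (max |t| (|x| + 1)))
  refine exists_isBiPoissonOrthogonality R fun f hf => ?_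
  rw [← eval_transitionOp]
  rw [mem_closure_iff_frequently] at hx
  have h1 : ∀ᶠ z in 𝓝 x, |z| < |x| + 1 :=
    (continuous_abs.tendsto x).eventually_lt_const (by linarith)
  refine ge_of_tendsto_of_frequently ((transitionOp q η θ s t f).continuous.tendsto x)
    ((hx.and_eventually h1).mono ?_)
  rintro z ⟨⟨ρ, hρ⟩, hz⟩
  rw [eval_transitionOp]
  exact biPoissonFunctional_nonneg hρ hR (hb s t z (le_max_left _ _)
    ((le_max_left _ _).trans (le_max_right _ _))
    (hz.le.trans ((le_max_right _ _).trans (le_max_right _ _)))) hf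

/-- If all the transition measures `P_{t,u}(x, dy)`, `u > t`, exist, then the measure in the
generator exists. -/
lemma exists_isBiPoissonOrthogonality_generator (hq : -1 < q) (hq' : q < 1)
    (h : ∀ u, t < u → ∃ ρ, IsBiPoissonOrthogonality q η θ t u x ρ) (hx : 1 + η * x ≠ 0) :
    ∃ ρ, IsBiPoissonOrthogonality q η θ (q ^ 2 * t) t (q * (x - t * η) + θ) ρ := by
  have hpos : 0 < 1 + η * x := by
    obtain ⟨ρ, hρ⟩ := h (t + 1) (by linarith)
    have h1 := integral_eval_of_isBiPoissonOrthogonality hρ ((X - C x) ^ 2)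
    have h2 : 0 ≤ ∫ y, ((X - C x) ^ 2 : ℝ[X]).eval y ∂ρ :=
      integral_nonneg fun y => by simp only [eval_pow]; positivity
    rw [h1, biPoissonFunctional_sq, add_sub_cancel_left, one_mul] at h2
    exact lt_of_le_of_ne h2 hx.symm
  obtain ⟨R, hR, hb⟩ := exists_biPoissonFunctional_bound η θ hq hq' (max (|t| + 1) |x|)
  refine exists_isBiPoissonOrthogonality R fun f hf => ?_
  -- The generator of (y - x)² f(y) at x is 1 + ηx times the functional of f. The difference
  -- quotients are nonnegative, since this polynomial vanishes at x and is nonnegative on the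
  -- interval carrying P_{t,u}(x,dy).
  have h1 := (hasDerivAt_transitionOp q η θ t x ((X - C x) * ((X - C x) * f))).tendsto_slope
  rw [generatorFunctional_apply, divDiff_X_sub_C_mul, divDiff_X_sub_C_mul] at h1
  have h2 : Tendsto _ (𝓝[>] t) _ := h1.mono_left (nhdsWithin_mono t (fun u (hu : t < u) => hu.ne' : Set.Ioi t ⊆ {t}ᶜ))
  refine (mul_nonneg_iff_of_pos_left hpos).1 (ge_of_tendsto h2 ?_)
  filter_upwards [Ioo_mem_nhdsGT (show t < t + 1 by linarith)] with u hu
  obtain ⟨ρ, hρ⟩ := h u hu.1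
  rw [slope_def_field, transitionOp_self, eval_mul, eval_transitionOp]
  have h0 : |t| ≤ max (|t| + 1) |x| := (by linarith : |t| ≤ |t| + 1).trans (le_max_left _ _)
  have h3 : |u| ≤ max (|t| + 1) |x| := by
    refine le_trans ?_ (le_max_left _ _)
    have := abs_add_le t (u - t)
    rw [add_sub_cancel, abs_of_pos (sub_pos.2 hu.1)] at this
    linarith [hu.2]
  refine div_nonneg ?_ (sub_pos.2 hu.1).le
  simp only [eval_sub, eval_X, eval_C, sub_self, zero_mul, sub_zero]
  refine biPoissonFunctional_nonneg hρ hR (hb t u x h0 h3 (le_max_right _ _)) fun y hy => ?_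
  simp only [eval_mul, eval_sub, eval_X, eval_C, ← mul_assoc]
  exact mul_nonneg (mul_self_nonneg _) (hf y hy)

end orthogonality

/-! ### Conditional moments of the process -/

section process

variable {Ω : Type*} {X : ℝ≥0 → Ω → ℝ}

lemma pastSigma_le [mΩ : MeasurableSpace Ω] (hX : ∀ t, Measurable (X t)) (s : ℝ≥0) : pastSigma X s ≤ mΩ :=
  iSup₂_le fun r _ => (hX r).comap_le

lemma pastFutureSigma_le [mΩ : MeasurableSpace Ω] (hX : ∀ t, Measurable (X t)) (s u : ℝ≥0) :
    pastFutureSigma X s u ≤ mΩ :=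
  iSup₂_le fun r _ => (hX r).comap_le

lemma pastSigma_mono {s t : ℝ≥0} (h : s ≤ t) : pastSigma X s ≤ pastSigma X t :=
  iSup₂_le fun r hr => le_iSup₂_of_le r (hr.trans h) le_rfl

lemma pastSigma_le_pastFutureSigma (s u : ℝ≥0) : pastSigma X s ≤ pastFutureSigma X s u :=
  iSup₂_le fun r hr => le_iSup₂_of_le r (Or.inl hr) le_rfl

lemma measurable_pastSigma {r s : ℝ≥0} (h : r ≤ s) : Measurable[pastSigma X s] (X r) :=
  (comap_measurable (X r)).mono (le_iSup₂_of_le r h le_rfl) le_rfl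

lemma measurable_pastFutureSigma {r s u : ℝ≥0} (h : r ≤ s ∨ u ≤ r) :
    Measurable[pastFutureSigma X s u] (X r) :=
  (comap_measurable (X r)).mono (le_iSup₂_of_le r h le_rfl) le_rfl

lemma stronglyMeasurable_eval {m : MeasurableSpace Ω} {Y : Ω → ℝ} (h : Measurable[m] Y)
    (f : ℝ[X]) : StronglyMeasurable[m] fun ω => f.eval (Y ω) :=
  (f.continuous.measurable.comp h).stronglyMeasurable

variable [mΩ : MeasurableSpace Ω] {P : Measure Ω}

lemma integrable_eval_process (hmom : ∀ (t : ℝ≥0) (n : ℕ), Integrable (fun ω => X t ω ^ n) P)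
    (t : ℝ≥0) (f : ℝ[X]) : Integrable (fun ω => f.eval (X t ω)) P := by
  simp only [eval_eq_sum_range]
  exact integrable_finsetSum _ fun i _ => (hmom t i).const_mul _

variable (hX : ∀ t, Measurable (X t))
  (hmom : ∀ (t : ℝ≥0) (n : ℕ), Integrable (fun ω => X t ω ^ n) P)
include hX hmom

lemma memLp_eval_process (t : ℝ≥0) (f : ℝ[X]) : MemLp (fun ω => f.eval (X t ω)) 2 P := by
  rw [memLp_two_iff_integrable_sq (stronglyMeasurable_eval (hX t) f).aestronglyMeasurable]
  have h := integrable_eval_process hmom t (f ^ 2)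
  simp only [eval_pow] at h
  exact h

lemma integrable_eval_mul_eval (s t : ℝ≥0) (f g : ℝ[X]) :
    Integrable (fun ω => f.eval (X s ω) * g.eval (X t ω)) P :=
  (memLp_eval_process hX hmom s f).integrable_mul (memLp_eval_process hX hmom t g)

variable [IsProbabilityMeasure P]

/-- Two evaluations of `E(f(X_t) g(X_u) | F_s)`, by conditioning on `F_{s,u}` and on `F_t`. -/
lemma condExp_two_ways {s t u : ℝ≥0} (hst : s < t) {f g b0 b1 b2 T : ℝ[X]}
    (hf : P[fun ω => f.eval (X t ω) | pastFutureSigma X s u] =ᵐ[P] fun ω =>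
      b0.eval (X u ω) + X s ω * b1.eval (X u ω) + X s ω ^ 2 * b2.eval (X u ω))
    (hg : P[fun ω => g.eval (X u ω) | pastSigma X t] =ᵐ[P] fun ω => T.eval (X t ω)) :
    P[fun ω => (f * T).eval (X t ω) | pastSigma X s] =ᵐ[P] fun ω =>
      P[fun ω => (b0 * g).eval (X u ω) | pastSigma X s] ω +
      X s ω * P[fun ω => (b1 * g).eval (X u ω) | pastSigma X s] ω +
      X s ω ^ 2 * P[fun ω => (b2 * g).eval (X u ω) | pastSigma X s] ω := by
  have hfg : Integrable (fun ω => f.eval (X t ω) * g.eval (X u ω)) P :=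
    integrable_eval_mul_eval hX hmom t u f g
  have h1 : P[fun ω => f.eval (X t ω) * g.eval (X u ω) | pastSigma X t] =ᵐ[P]
      fun ω => (f * T).eval (X t ω) := by
    refine (condExp_mul_of_stronglyMeasurable_left
      (stronglyMeasurable_eval (measurable_pastSigma le_rfl) f) hfg
      (integrable_eval_process hmom u g)).trans ?_
    filter_upwards [hg] with ω hω
    rw [Pi.mul_apply, hω, eval_mul]
  have h2 : P[fun ω => f.eval (X t ω) * g.eval (X u ω) | pastFutureSigma X s u] =ᵐ[P]
      fun ω => (b0 * g).eval (X u ω) + X s ω * (b1 * g).eval (X u ω) +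
        X s ω ^ 2 * (b2 * g).eval (X u ω) := by
    refine (condExp_mul_of_stronglyMeasurable_right
      (stronglyMeasurable_eval (measurable_pastFutureSigma (Or.inr le_rfl)) g) hfg
      (integrable_eval_process hmom t f)).trans ?_
    filter_upwards [hf] with ω hω
    rw [Pi.mul_apply, hω]
    simp only [eval_mul]
    ring
  have h3 := (condExp_congr_ae (m := pastSigma X s) h1).symm.trans
    (condExp_condExp_of_le (pastSigma_mono hst.le) (pastSigma_le hX t))
  have h4 := (condExp_condExp_of_le (pastSigma_le_pastFutureSigma s u)
    (pastFutureSigma_le hX s u)).symm.trans (condExp_congr_ae (m := pastSigma X s) h2)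
  refine (h3.trans h4).trans ?_
  have hi0 := integrable_eval_process hmom u (b0 * g)
  have hi1 : Integrable (fun ω => X s ω * (b1 * g).eval (X u ω)) P := by
    simpa only [eval_X] using integrable_eval_mul_eval hX hmom s u Polynomial.X (b1 * g)
  have hi2 : Integrable (fun ω => X s ω ^ 2 * (b2 * g).eval (X u ω)) P := by
    have h := integrable_eval_mul_eval hX hmom s u (Polynomial.X ^ 2) (b2 * g)
    simp only [eval_X, eval_pow] at h
    exact h
  have hm : Measurable[pastSigma X s] (X s) := measurable_pastSigma le_rfl
  have e1 := condExp_mul_of_stronglyMeasurable_left (m := pastSigma X s) hm.stronglyMeasurable hi1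
    (integrable_eval_process hmom u (b1 * g))
  have e2 := condExp_mul_of_stronglyMeasurable_left (m := pastSigma X s)
    (f := fun ω => X s ω ^ 2) (hm.pow_const 2).stronglyMeasurable hi2
    (integrable_eval_process hmom u (b2 * g))
  refine (condExp_add (hi0.add hi1) hi2 _).trans ?_
  filter_upwards [condExp_add hi0 hi1 (pastSigma X s), e1, e2] with ω h5 h6 h7
  rw [Pi.add_apply, h5, Pi.add_apply]
  exact congrArg₂ _ (congrArg₂ _ rfl h6) h7

end process

/-! ### Second moments and the martingale property -/

section harness

variable {Ω : Type*} [mΩ : MeasurableSpace Ω] {P : Measure Ω} [IsProbabilityMeasure P]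
  {X : ℝ≥0 → Ω → ℝ} {q η θ : ℝ} (hX : IsStandardQuadraticHarness θ η 0 0 q P X)
include hX

/-- The covariance is given only for distinct times. Multiplying the harness identity at s < s + 1 <
s + 2 by X_s gives s = E(X_s²)/2 + s/2. -/
lemma integral_mul_self (s : ℝ≥0) : ∫ ω, X s ω * X s ω ∂P = s := by
  have hst : s < s + 1 := by simp
  have htu : s + 1 < s + 1 + 1 := by simp
  have hi : ∀ r, Integrable (fun ω => X s ω * X r ω) P := fun r =>
    (hX.memLp_two s).integrable_mul (hX.memLp_two r)
  have h1 := condExp_mul_of_stronglyMeasurable_left (m := pastFutureSigma X s (s + 1 + 1))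
    (measurable_pastFutureSigma (Or.inl le_rfl)).stronglyMeasurable (hi (s + 1))
    ((hX.memLp_two (s + 1)).integrable one_le_two)
  have h2 := integral_condExp (μ := P) (f := fun ω => X s ω * X (s + 1) ω)
    (pastFutureSigma_le hX.measurable s (s + 1 + 1))
  rw [hX.covariance _ _ hst] at h2
  have h3 : ∫ ω, (1 / 2 * (X s ω * X s ω) + 1 / 2 * (X s ω * X (s + 1 + 1) ω)) ∂P = s := by
    rw [← h2]
    refine integral_congr_ae ?_
    filter_upwards [h1, hX.harness _ _ _ hst htu] with ω h4 h5
    refine Eq.trans ?_ h4.symm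
    rw [Pi.mul_apply, h5]
    push_cast
    have e1 : (s : ℝ) + 1 + 1 - (s + 1) = 1 := by ring
    have e2 : (s : ℝ) + 1 + 1 - s = 2 := by ring
    have e3 : (s : ℝ) + 1 - s = 1 := by ring
    rw [e1, e2, e3]; ring
  rw [integral_add ((hi _).const_mul _) ((hi _).const_mul _), integral_const_mul, integral_const_mul,
    hX.covariance _ _ (hst.trans htu)] at h3
  linarith

lemma integral_abs_increment_le {s u : ℝ≥0} (h : s < u) {K : ℝ} (hK : 0 < K) :
    ∫ ω, |X u ω - X s ω| ∂P ≤ ((u : ℝ) - s) / K + K := by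
  have hi : ∀ r r', Integrable (fun ω => X r ω * X r' ω) P := fun r r' =>
    (hX.memLp_two r).integrable_mul (hX.memLp_two r')
  have h1 : ∫ ω, (X u ω - X s ω) ^ 2 ∂P = u - s := by
    have : ∀ ω, (X u ω - X s ω) ^ 2 = X u ω * X u ω - 2 * (X s ω * X u ω) + X s ω * X s ω :=
      fun ω => by ring
    have h2 : Integrable (fun ω => X u ω * X u ω - 2 * (X s ω * X u ω)) P :=
      (hi _ _).sub ((hi _ _).const_mul _)
    simp only [this]
    rw [integral_add h2 (hi _ _),
      integral_sub (hi _ _) ((hi _ _).const_mul _), integral_const_mul, hX.covariance _ _ h,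
      integral_mul_self hX, integral_mul_self hX]
    ring
  have hd := (hX.memLp_two u).sub (hX.memLp_two s)
  have hsq : Integrable (fun ω => (X u ω - X s ω) ^ 2) P := hd.integrable_sq
  have h2 : ∫ ω, |X u ω - X s ω| ∂P ≤ ∫ ω, ((X u ω - X s ω) ^ 2 / K + K) ∂P := by
    refine integral_mono (hd.integrable one_le_two).abs
      ((hsq.div_const K).add (integrable_const K)) fun ω => ?_
    simp only
    rw [← sq_abs, div_add' _ _ _ hK.ne', le_div_iff₀ hK]
    nlinarith [sq_nonneg (|X u ω - X s ω| - K), abs_nonneg (X u ω - X s ω)]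
  rw [integral_add (hsq.div_const K) (integrable_const K), integral_div, h1] at h2
  simpa using h2

/-- The harness property gives E(X_t - X_s | F_s) = (t - s)/(u - s) · E(X_u - X_s | F_s) for every u
> t. The increment has L¹ norm of order √(u - s), so the right side tends to 0 in L¹ as u → ∞. -/
lemma condExp_process {s t : ℝ≥0} (hst : s < t) :
    P[X t | pastSigma X s] =ᵐ[P] X s := by
  have hi : ∀ r, Integrable (X r) P := fun r => (hX.memLp_two r).integrable one_le_two
  have hm := pastSigma_le hX.measurable s
  have hd : ∀ u, t < u → P[X t - X s | pastSigma X s] =ᵐ[P] fun ω =>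
      ((t : ℝ) - s) / (u - s) * P[X u - X s | pastSigma X s] ω := by
    intro u htu
    have hus : (u : ℝ) - s ≠ 0 := (sub_pos.2 (NNReal.coe_lt_coe.2 (hst.trans htu))).ne'
    have h1 : P[X t - X s | pastFutureSigma X s u] =ᵐ[P]
        (((t : ℝ) - s) / (u - s)) • (X u - X s) := by
      refine (condExp_sub (hi t) (hi s) _).trans ?_
      have h2 : P[X s | pastFutureSigma X s u] = X s :=
        condExp_of_stronglyMeasurable (pastFutureSigma_le hX.measurable s u)
          (measurable_pastFutureSigma (Or.inl le_rfl)).stronglyMeasurable (hi s)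
      filter_upwards [hX.harness s t u hst htu] with ω h3
      rw [Pi.sub_apply, h2, h3, Pi.smul_apply, Pi.sub_apply, smul_eq_mul]
      field_simp
      ring
    refine (condExp_condExp_of_le (pastSigma_le_pastFutureSigma s u)
      (pastFutureSigma_le hX.measurable s u)).symm.trans ?_
    refine (condExp_congr_ae h1).trans (condExp_smul _ _ _)
  have hts : 0 < (t : ℝ) - s := sub_pos.2 (NNReal.coe_lt_coe.2 hst)
  have hbound : ∀ k : ℕ, (t : ℝ) - s < k →
      ∫ ω, |P[X t - X s | pastSigma X s] ω| ∂P ≤ 2 * ((t : ℝ) - s) / k := by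
    intro k hk
    have hk0 : (0 : ℝ) < k := hts.trans hk
    have hk1 : (1 : ℝ) ≤ k := by exact_mod_cast Nat.one_le_iff_ne_zero.2 (by rintro rfl; simp at hk0)
    -- With u - s = k² and K = k the two terms (u - s)/K and K balance.
    let u : ℝ≥0 := s + k ^ 2
    have hu : (u : ℝ) - s = k ^ 2 := by simp [u]
    have htu : t < u := by
      rw [← NNReal.coe_lt_coe]; nlinarith
    calc ∫ ω, |P[X t - X s | pastSigma X s] ω| ∂P
        = ∫ ω, ((t : ℝ) - s) / (u - s) * |P[X u - X s | pastSigma X s] ω| ∂P := by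
          refine integral_congr_ae ?_
          filter_upwards [hd u htu] with ω hω
          rw [hω, abs_mul, abs_of_pos (div_pos hts (by rw [hu]; positivity))]
      _ = ((t : ℝ) - s) / (u - s) * ∫ ω, |P[X u - X s | pastSigma X s] ω| ∂P :=
          integral_const_mul _ _
      _ ≤ ((t : ℝ) - s) / (u - s) * (((u : ℝ) - s) / k + k) := by
          rw [hu]
          gcongr
          refine (integral_abs_condExp_le _).trans ?_
          rw [← hu]
          exact integral_abs_increment_le hX (hst.trans htu) hk0
      _ = 2 * ((t : ℝ) - s) / k := by rw [hu]; field_simp; ring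
  have h0 : ∫ ω, |P[X t - X s | pastSigma X s] ω| ∂P ≤ 0 := by
    refine ge_of_tendsto (tendsto_const_div_atTop_nhds_zero_nat (2 * ((t : ℝ) - s))) ?_
    filter_upwards [tendsto_natCast_atTop_atTop.eventually_gt_atTop ((t : ℝ) - s)] with k hk
      using hbound k hk
  have h1 : (fun ω => |P[X t - X s | pastSigma X s] ω|) =ᵐ[P] 0 :=
    (integral_eq_zero_iff_of_nonneg (fun ω => abs_nonneg _) integrable_condExp.abs).1
      (le_antisymm h0 (integral_nonneg fun ω => abs_nonneg _))
  have h2 : P[X s | pastSigma X s] = X s :=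
    condExp_of_stronglyMeasurable hm (measurable_pastSigma le_rfl).stronglyMeasurable (hi s)
  filter_upwards [h1, condExp_sub (hi t) (hi s) (pastSigma X s)] with ω h3 h4
  rw [Pi.zero_apply, abs_eq_zero, h4, Pi.sub_apply, h2] at h3
  linarith

end harness

lemma X_pow_mul_mem_degreeLT {m n : ℕ} (j : ℕ) (h : m + j ≤ n) {f : ℝ[X]} (hf : f ∈ degreeLT ℝ m) :
    X ^ j * f ∈ degreeLT ℝ n := by
  rcases eq_or_ne f 0 with rfl | h0
  · simp
  rw [mem_degreeLT] at *
  rw [mul_comm, degree_mul_X_pow, degree_eq_natDegree h0] at *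
  exact_mod_cast lt_of_lt_of_le (Nat.add_lt_add_right (by exact_mod_cast hf) j) h

lemma X_pow_mem_degreeLT {j n : ℕ} (h : j < n) : (X ^ j : ℝ[X]) ∈ degreeLT ℝ n :=
  mem_degreeLT.2 ((degree_X_pow_le j).trans_lt (by exact_mod_cast h))

lemma ae_integrable_condDistrib {α β : Type*} {mα : MeasurableSpace α} {mβ : MeasurableSpace β}
    {μ : Measure α} [IsFiniteMeasure μ] {X : α → β} {Y : α → ℝ} (hX : Measurable X)
    (hY : Measurable Y) {f : ℝ → ℝ} (hf : Measurable f) (hint : Integrable (fun a => f (Y a)) μ) :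
    ∀ᵐ a ∂μ, Integrable f (condDistrib Y X μ (X a)) := by
  have h : Integrable (fun p : β × ℝ => f p.2) (μ.map fun a => (X a, Y a)) := by
    have h' : Measurable fun p : β × ℝ => f p.2 := hf.comp measurable_snd
    rwa [integrable_map_measure h'.aestronglyMeasurable (hX.prodMk hY).aemeasurable]
  exact h.condDistrib_ae hX.aemeasurable hY.aemeasurable

/-! ### Polynomial regression by induction on the degree, and the conditional laws -/

section regression

variable {Ω : Type*} [mΩ : MeasurableSpace Ω] (P : Measure Ω) (X : ℝ≥0 → Ω → ℝ) (q η θ : ℝ)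

/-- The conditional expectations of polynomials of degree less than `n` are given by the
transition operators. -/
def HasPolynomialRegression (n : ℕ) : Prop :=
  ∀ s u : ℝ≥0, s < u → ∀ f ∈ degreeLT ℝ n, P[fun ω => f.eval (X u ω) | pastSigma X s] =ᵐ[P]
    fun ω => (transitionOp q η θ s u f).eval (X s ω)

/-- The error in the formula for the conditional expectation of `X_u ^ n`. -/
noncomputable def regressionError (n : ℕ) (s u : ℝ≥0) (ω : Ω) : ℝ :=
  P[fun ω => (Polynomial.X ^ n : ℝ[X]).eval (X u ω) | pastSigma X s] ω -
    (transitionOp q η θ s u (Polynomial.X ^ n)).eval (X s ω)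

variable {P X q η θ}

lemma condExp_eval_eq_add_regressionError [IsProbabilityMeasure P]
    (hmom : ∀ (t : ℝ≥0) (n : ℕ), Integrable (fun ω => X t ω ^ n) P) {n : ℕ}
    (ih : HasPolynomialRegression P X q η θ n) {s u : ℝ≥0} (h : s < u) {f : ℝ[X]} (a : ℝ)
    (hf : f - a • Polynomial.X ^ n ∈ degreeLT ℝ n) :
    P[fun ω => f.eval (X u ω) | pastSigma X s] =ᵐ[P] fun ω =>
      (transitionOp q η θ s u f).eval (X s ω) + a * regressionError P X q η θ n s u ω := by
  have h1 := ih s u h _ hf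
  set r := f - a • Polynomial.X ^ n with hr
  have h2 : f = r + a • Polynomial.X ^ n := by rw [hr]; ring
  have h3 : (fun ω => f.eval (X u ω)) = (fun ω => r.eval (X u ω)) +
      a • fun ω => (Polynomial.X ^ n : ℝ[X]).eval (X u ω) := by
    funext ω
    rw [h2]
    simp only [eval_add, eval_smul, Pi.add_apply, Pi.smul_apply]
  rw [h3]
  filter_upwards [condExp_add (integrable_eval_process hmom u r)
    ((integrable_eval_process hmom u (Polynomial.X ^ n)).smul a) (pastSigma X s), h1,
    condExp_smul (μ := P) a (fun ω => (Polynomial.X ^ n : ℝ[X]).eval (X u ω)) (pastSigma X s)]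
    with ω e1 e2 e3
  rw [e1, Pi.add_apply, e2, e3, h2, map_add, map_smul, eval_add, eval_smul, regressionError,
    Pi.smul_apply, smul_eq_mul, smul_eq_mul]
  ring

lemma hasPolynomialRegression_two [IsProbabilityMeasure P]
    (hX : IsStandardQuadraticHarness θ η 0 0 q P X) : HasPolynomialRegression P X q η θ 2 := by
  intro s u hsu f hf
  obtain ⟨a, b, rfl⟩ := exists_eq_X_add_C_of_natDegree_le_one (p := f) (by
    rw [show 2 = 1 + 1 from rfl, degreeLT_succ_eq_degreeLE, mem_degreeLE] at hf
    exact natDegree_le_of_degree_le hf)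
  have hm := pastSigma_le hX.measurable s
  have h1 : (fun ω => (C a * Polynomial.X + C b : ℝ[X]).eval (X u ω)) = a • X u + fun _ => b := by
    funext ω; simp
  have h2 : transitionOp q η θ s u (C a * Polynomial.X + C b) = C a * Polynomial.X + C b := by
    have h3 := transitionOp_X_mul q η θ s u 1
    simp only [mul_one, transitionOp_one, heatEquiv_one, twistedDerivation_one, map_zero, smul_zero,
      add_zero] at h3
    have hC : (C b : ℝ[X]) = b • 1 := by rw [smul_eq_C_mul, mul_one]
    rw [← smul_eq_C_mul, hC, map_add, map_smul, map_smul, h3, transitionOp_one]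
  rw [h1, h2]
  have hi : Integrable (X u) P := (hX.memLp_two u).integrable one_le_two
  filter_upwards [condExp_add (hi.smul a) (integrable_const b) (pastSigma X s),
    condExp_smul a (X u) (pastSigma X s) (μ := P), condExp_process hX hsu] with ω e1 e2 e3
  rw [e1, Pi.add_apply, e2, condExp_const hm, Pi.smul_apply, e3]
  simp

variable [IsProbabilityMeasure P] (hX : IsStandardQuadraticHarness θ η 0 0 q P X)
  (hmom : ∀ (t : ℝ≥0) (n : ℕ), Integrable (fun ω => X t ω ^ n) P)
include hX hmom

/-- E(X_t X_u^(k+1) | F_s) is computed in two ways. Conditioning on F_t leaves a monic polynomial of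
degree k + 2 in X_t; conditioning on F_{s,u} leaves X_u^(k+2) with coefficient (t - s)/(u - s). The
other terms carry no error, and the operator parts agree by `transitionOp_harness`. -/
lemma regressionError_harness {k : ℕ} (ih : HasPolynomialRegression P X q η θ (k + 2))
    {s t u : ℝ≥0} (hst : s < t) (htu : t < u) :
    regressionError P X q η θ (k + 2) s t =ᵐ[P] fun ω =>
      ((t : ℝ) - s) / (u - s) * regressionError P X q η θ (k + 2) s u ω := by
  have hsu := hst.trans htu
  have hus : (u : ℝ) - s ≠ 0 := (sub_pos.2 (NNReal.coe_lt_coe.2 hsu)).ne'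
  set a : ℝ := ((t : ℝ) - s) / (u - s) with ha
  set b : ℝ := ((u : ℝ) - t) / (u - s) with hb
  let g : ℝ[X] := Polynomial.X ^ (k + 1)
  have hf : P[fun ω => (Polynomial.X : ℝ[X]).eval (X t ω) | pastFutureSigma X s u] =ᵐ[P] fun ω =>
      (C a * Polynomial.X).eval (X u ω) + X s ω * (C b).eval (X u ω) +
        X s ω ^ 2 * (0 : ℝ[X]).eval (X u ω) := by
    simp only [eval_X]
    filter_upwards [hX.harness s t u hst htu] with ω hω
    rw [hω]
    simp
    ring
  have h1 := condExp_two_ways hX.measurable hmom hst hf (ih t u htu g (X_pow_mem_degreeLT (by omega)))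
  have hT : Polynomial.X * transitionOp q η θ t u g - (1 : ℝ) • Polynomial.X ^ (k + 2) ∈
      degreeLT ℝ (k + 2) := by
    have := X_pow_mul_mem_degreeLT 1 (n := k + 2) (by omega)
      (isUnipotent_transitionOp q η θ t u (k + 1))
    convert this using 1
    simp only [LinearEquiv.coe_coe, g, one_smul]; ring
  have h2 := condExp_eval_eq_add_regressionError hmom ih hst 1 hT
  have h3 := condExp_eval_eq_add_regressionError hmom ih hsu (f := C a * Polynomial.X * g) a (by
    convert (degreeLT ℝ (k + 2)).zero_mem using 1
    simp only [g, smul_eq_C_mul]; ring)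
  have h4 := ih s u hsu (C b * g) (by
    rw [← smul_eq_C_mul]; exact Submodule.smul_mem _ _ (X_pow_mem_degreeLT (by omega)))
  have h5 : transitionOp q η θ s t (Polynomial.X * transitionOp q η θ t u g) =
      transitionOp q η θ s u (C a * Polynomial.X * g) +
        Polynomial.X * transitionOp q η θ s u (C b * g) := by
    have h6 := transitionOp_harness q η θ s t u g
    have h7 : C a * Polynomial.X * g = a • (Polynomial.X * g) := by rw [smul_eq_C_mul]; ring
    rw [h7, ← smul_eq_C_mul, map_smul, map_smul, mul_smul_comm]
    apply smul_right_injective ℝ[X] hus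
    simp only
    rw [h6, smul_add, smul_smul, smul_smul, ha, hb, mul_div_cancel₀ _ hus, mul_div_cancel₀ _ hus,
      add_comm]
  filter_upwards [h1, h2, h3, h4] with ω e1 e2 e3 e4
  rw [e1, e3, e4, h5] at e2
  have e5 : P[fun ω => ((0 : ℝ[X]) * g).eval (X u ω) | pastSigma X s] = 0 := by
    simp only [zero_mul, eval_zero]; exact condExp_zero
  rw [e5, Pi.zero_apply] at e2
  simp only [eval_add, eval_mul, eval_X] at e2
  linarith

omit hmom in
lemma condExp_sq_pastFutureSigma (hq' : q < 1) {s t u : ℝ≥0} (hst : s < t) (htu : t < u) :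
    P[fun ω => X t ω ^ 2 | pastFutureSigma X s u] =ᵐ[P] fun ω =>
      (((u : ℝ) - q * s) * (u - s))⁻¹ * (((t : ℝ) - s) * (t - q * s) * X u ω ^ 2 +
        ((u : ℝ) - t) * (t - s) * (1 + q) * (X s ω * X u ω) +
        ((u : ℝ) - t) * (u - q * t) * X s ω ^ 2 +
        ((u : ℝ) - t) * (t - s) * ((u - s) + θ * (X u ω - X s ω) +
          η * (u * X s ω - s * X u ω))) := by
  have hus : (0 : ℝ) < u - s := sub_pos.2 (NNReal.coe_lt_coe.2 (hst.trans htu))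
  have huq : (0 : ℝ) < u - q * s := by
    have : q * s ≤ 1 * s := mul_le_mul_of_nonneg_right hq'.le s.2
    linarith
  have h1 := condVar_ae_eq_condExp_sq_sub_sq_condExp (pastFutureSigma_le hX.measurable s u)
    (hX.memLp_two t)
  filter_upwards [h1, hX.harness s t u hst htu, hX.variance s t u hst htu] with ω e1 e2 e3
  rw [e3, Pi.sub_apply, Pi.pow_apply, e2] at e1
  have e4 : P[X t ^ 2 | pastFutureSigma X s u] ω = P[fun ω => X t ω ^ 2 | pastFutureSigma X s u] ω :=
    rfl
  rw [e4] at e1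
  rw [sub_eq_iff_eq_add.1 e1.symm]
  have hus' := hus.ne'
  have huq' : (u : ℝ) - s * q ≠ 0 := by rw [mul_comm]; exact huq.ne'
  simp only [quadraticForm, zero_mul, add_zero, mul_one]
  field_simp
  ring

/-- The same comparison for E(X_t² X_u^k | F_s), with `transitionOp_variance`. The factor is the
coefficient of X_u² in E(X_t² | F_{s,u}). -/
lemma regressionError_variance (hq' : q < 1) {k : ℕ}
    (ih : HasPolynomialRegression P X q η θ (k + 2)) {s t u : ℝ≥0} (hst : s < t) (htu : t < u) :
    regressionError P X q η θ (k + 2) s t =ᵐ[P] fun ω =>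
      (((u : ℝ) - q * s) * (u - s))⁻¹ * (((t : ℝ) - s) * (t - q * s)) *
        regressionError P X q η θ (k + 2) s u ω := by
  have hsu := hst.trans htu
  have hus : (0 : ℝ) < u - s := sub_pos.2 (NNReal.coe_lt_coe.2 hsu)
  have huq : (0 : ℝ) < u - q * s := by
    have : q * s ≤ 1 * s := mul_le_mul_of_nonneg_right hq'.le s.2
    linarith
  obtain ⟨N, hN⟩ : ∃ N : ℝ, N = ((u : ℝ) - q * s) * (u - s) := ⟨_, rfl⟩
  have hN0 : N ≠ 0 := by rw [hN]; exact (mul_pos huq hus).ne'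
  obtain ⟨a2, ha2⟩ : ∃ a : ℝ, a = N⁻¹ * (((t : ℝ) - s) * (t - q * s)) := ⟨_, rfl⟩
  obtain ⟨a1, ha1⟩ : ∃ a : ℝ, a = N⁻¹ * (((u : ℝ) - t) * (t - s) * (θ - η * s)) := ⟨_, rfl⟩
  obtain ⟨a0, ha0⟩ : ∃ a : ℝ, a = N⁻¹ * (((u : ℝ) - t) * (t - s) * (u - s)) := ⟨_, rfl⟩
  obtain ⟨b1, hb1⟩ : ∃ a : ℝ, a = N⁻¹ * (((u : ℝ) - t) * (t - s) * (1 + q)) := ⟨_, rfl⟩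
  obtain ⟨b0, hb0⟩ : ∃ a : ℝ, a = N⁻¹ * (((u : ℝ) - t) * (t - s) * (η * u - θ)) := ⟨_, rfl⟩
  obtain ⟨c0, hc0⟩ : ∃ a : ℝ, a = N⁻¹ * (((u : ℝ) - t) * (u - q * t)) := ⟨_, rfl⟩
  rw [← hN, ← ha2]
  let g : ℝ[X] := Polynomial.X ^ k
  have hf : P[fun ω => (Polynomial.X ^ 2 : ℝ[X]).eval (X t ω) | pastFutureSigma X s u] =ᵐ[P] fun ω =>
      (C a2 * Polynomial.X ^ 2 + C a1 * Polynomial.X + C a0).eval (X u ω) +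
        X s ω * (C b1 * Polynomial.X + C b0).eval (X u ω) + X s ω ^ 2 * (C c0).eval (X u ω) := by
    simp only [eval_X, eval_pow]
    filter_upwards [condExp_sq_pastFutureSigma hX hq' hst htu] with ω hω
    rw [hω, ← hN]
    simp only [eval_add, eval_mul, eval_C, eval_X, eval_pow, ha2, ha1, ha0, hb1, hb0, hc0]
    ring
  have h1 := condExp_two_ways hX.measurable hmom hst hf (ih t u htu g (X_pow_mem_degreeLT (by omega)))
  have hT : Polynomial.X ^ 2 * transitionOp q η θ t u g - (1 : ℝ) • Polynomial.X ^ (k + 2) ∈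
      degreeLT ℝ (k + 2) := by
    have := X_pow_mul_mem_degreeLT 2 (n := k + 2) le_rfl (isUnipotent_transitionOp q η θ t u k)
    convert this using 1
    simp only [LinearEquiv.coe_coe, g, one_smul]; ring
  have m0 : g ∈ degreeLT ℝ (k + 2) := X_pow_mem_degreeLT (by omega)
  have m1 : Polynomial.X * g ∈ degreeLT ℝ (k + 2) := by
    have : Polynomial.X * g = Polynomial.X ^ (k + 1) := by simp only [g]; ring
    rw [this]; exact X_pow_mem_degreeLT (by omega)
  have eb2 : (C a2 * Polynomial.X ^ 2 + C a1 * Polynomial.X + C a0) * g =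
      a2 • (Polynomial.X * (Polynomial.X * g)) + a1 • (Polynomial.X * g) + a0 • g := by
    simp only [smul_eq_C_mul]; ring
  have eb1 : (C b1 * Polynomial.X + C b0) * g = b1 • (Polynomial.X * g) + b0 • g := by
    simp only [smul_eq_C_mul]; ring
  have eb0 : C c0 * g = c0 • g := by rw [smul_eq_C_mul]
  have h2 := condExp_eval_eq_add_regressionError hmom ih hst 1 hT
  have h3 := condExp_eval_eq_add_regressionError hmom ih hsu
    (f := (C a2 * Polynomial.X ^ 2 + C a1 * Polynomial.X + C a0) * g) a2 (by
    have : Polynomial.X * (Polynomial.X * g) = Polynomial.X ^ (k + 2) := by simp only [g]; ring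
    rw [eb2, this, add_assoc, add_sub_cancel_left]
    exact Submodule.add_mem _ (Submodule.smul_mem _ _ m1) (Submodule.smul_mem _ _ m0))
  have h4 := ih s u hsu ((C b1 * Polynomial.X + C b0) * g) (by
    rw [eb1]
    exact Submodule.add_mem _ (Submodule.smul_mem _ _ m1) (Submodule.smul_mem _ _ m0))
  have h4' := ih s u hsu (C c0 * g) (by rw [eb0]; exact Submodule.smul_mem _ _ m0)
  have h5 : transitionOp q η θ s t (Polynomial.X ^ 2 * transitionOp q η θ t u g) =
      transitionOp q η θ s u ((C a2 * Polynomial.X ^ 2 + C a1 * Polynomial.X + C a0) * g) +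
        Polynomial.X * transitionOp q η θ s u ((C b1 * Polynomial.X + C b0) * g) +
        Polynomial.X ^ 2 * transitionOp q η θ s u (C c0 * g) := by
    have h6 := transitionOp_variance q η θ s t u g
    have h7 : Polynomial.X ^ 2 * transitionOp q η θ t u g =
      Polynomial.X * (Polynomial.X * transitionOp q η θ t u g) := by ring
    have h8 : ∀ r : ℝ[X], Polynomial.X ^ 2 * r = Polynomial.X * (Polynomial.X * r) := fun r => by ring
    rw [← hN] at h6
    rw [h7, h8, eb2, eb1, eb0]
    have h9 := congrArg (fun f => N⁻¹ • f) h6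
    simp only [smul_smul, inv_mul_cancel₀ hN0, one_smul] at h9
    rw [h9]
    simp only [map_add, map_smul, ha2, ha1, ha0, hb1, hb0, hc0, mul_add, mul_smul_comm]
    match_scalars <;> ring
  filter_upwards [h1, h2, h3, h4, h4'] with ω e1 e2 e3 e4 e4'
  rw [e1, e3, e4, e4', h5] at e2
  simp only [eval_add, eval_mul, eval_X, eval_pow] at e2 ⊢
  linarith

/-- The factors in the two error relations differ by (t - s)(u - t)/((u - qs)(u - s)) > 0, so the
error from s to u is zero. -/
lemma hasPolynomialRegression_succ (hq' : q < 1) {k : ℕ}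
    (ih : HasPolynomialRegression P X q η θ (k + 2)) :
    HasPolynomialRegression P X q η θ (k + 3) := by
  intro s u hsu f hf
  obtain ⟨t, hst, htu⟩ := exists_between hsu
  have hus : (0 : ℝ) < u - s := sub_pos.2 (NNReal.coe_lt_coe.2 hsu)
  have hut : (0 : ℝ) < u - t := sub_pos.2 (NNReal.coe_lt_coe.2 htu)
  have hts : (0 : ℝ) < t - s := sub_pos.2 (NNReal.coe_lt_coe.2 hst)
  have huq : (0 : ℝ) < u - q * s := by
    have : q * s ≤ 1 * s := mul_le_mul_of_nonneg_right hq'.le s.2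
    linarith
  have h1 : f - f.coeff (k + 2) • Polynomial.X ^ (k + 2) ∈ degreeLT ℝ (k + 2) := by
    rw [mem_degreeLT, degree_lt_iff_coeff_zero]
    intro m hm
    rw [coeff_sub, coeff_smul, coeff_X_pow]
    rcases eq_or_lt_of_le hm with rfl | hm
    · simp
    · have := (degree_lt_iff_coeff_zero f (k + 3)).1 (mem_degreeLT.1 hf) m (by omega)
      rw [this, if_neg (by omega)]; simp
  filter_upwards [condExp_eval_eq_add_regressionError hmom ih hsu _ h1,
    regressionError_harness hX hmom ih hst htu, regressionError_variance hX hmom hq' ih hst htu]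
    with ω e1 e2 e3
  have e4 : regressionError P X q η θ (k + 2) s u ω = 0 := by
    rw [e2] at e3
    have h2 : (((t : ℝ) - s) / (u - s) - (((u : ℝ) - q * s) * (u - s))⁻¹ *
        (((t : ℝ) - s) * (t - q * s))) * regressionError P X q η θ (k + 2) s u ω = 0 := by
      linarith
    refine (mul_eq_zero.1 h2).resolve_left ?_
    have h3 : ((t : ℝ) - s) / (u - s) - (((u : ℝ) - q * s) * (u - s))⁻¹ *
        (((t : ℝ) - s) * (t - q * s)) = (t - s) * (u - t) / ((u - q * s) * (u - s)) := by
      have hus' := hus.ne'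
      have huq' : (u : ℝ) - s * q ≠ 0 := by rw [mul_comm]; exact huq.ne'
      field_simp
      ring
    rw [h3]
    positivity
  rw [e1, e4, mul_zero, add_zero]

/-- The conditional expectation of a polynomial of the process given the past is given by the
transition operator. -/
theorem condExp_eval_process (hq' : q < 1) {s u : ℝ≥0} (hsu : s < u) (f : ℝ[X]) :
    P[fun ω => f.eval (X u ω) | pastSigma X s] =ᵐ[P]
      fun ω => (transitionOp q η θ s u f).eval (X s ω) := by
  have h : ∀ k, HasPolynomialRegression P X q η θ (k + 2) := by
    intro k
    induction k with
    | zero => exact hasPolynomialRegression_two hX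
    | succ k ih => exact hasPolynomialRegression_succ hX hmom hq' ih
  refine h f.natDegree s u hsu f (mem_degreeLT.2 (degree_le_natDegree.trans_lt ?_))
  exact_mod_cast (by omega : f.natDegree < f.natDegree + 2)

/-! ### The Markov property -/

/-- The regular conditional distributions of `X_u` given the past are the transition measures. -/
theorem ae_condDistrib_eq (hq' : q < 1) {t u : ℝ≥0} (htu : t < u) :
    ∀ᵐ ω ∂P, IsBiPoissonOrthogonality q η θ t u (X t ω)
      (@condDistrib Ω Ω ℝ _ _ _ mΩ (pastSigma X t) (X u) id P _ ω) := by
  have hm := pastSigma_le hX.measurable t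
  -- Conditioning on the identity map into Ω with the past σ-algebra is conditioning on the whole
  -- past.
  have hid : @Measurable Ω Ω mΩ (pastSigma X t) id := measurable_id'' hm
  have h1 : ∀ᵐ ω ∂P, ∀ n : ℕ, Integrable (fun y : ℝ => y ^ n)
      (@condDistrib Ω Ω ℝ _ _ _ mΩ (pastSigma X t) (X u) id P _ ω) := by
    refine ae_all_iff.2 fun n => ?_
    exact ae_integrable_condDistrib (mβ := pastSigma X t) hid (hX.measurable u)
      (measurable_id.pow_const n) (hmom u n)
  have h2 : ∀ᵐ ω ∂P, ∀ n : ℕ, ∫ y, y ^ n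
      ∂(@condDistrib Ω Ω ℝ _ _ _ mΩ (pastSigma X t) (X u) id P _ ω) =
        (transitionOp q η θ t u (Polynomial.X ^ n)).eval (X t ω) := by
    refine ae_all_iff.2 fun n => ?_
    have e1 := condExp_ae_eq_integral_condDistrib (mβ := pastSigma X t) (X := id) (Y := X u) (μ := P)
      hid (hX.measurable u).aemeasurable (f := fun y => y ^ n)
      (measurable_id.pow_const n).stronglyMeasurable (hmom u n)
    rw [MeasurableSpace.comap_id] at e1
    have e2 := condExp_eval_process hX hmom hq' htu (Polynomial.X ^ n)
    simp only [eval_pow, eval_X] at e2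
    filter_upwards [e1, e2] with ω e3 e4
    exact e3.symm.trans e4
  filter_upwards [h1, h2] with ω e1 e2
  refine isBiPoissonOrthogonality_of_integral e1 fun f => ?_
  rw [← eval_transitionOp]
  exact linearMap_ext_X_pow (Φ := integralFunctional _ e1)
    (Ψ := leval (X t ω) ∘ₗ (transitionOp q η θ t u).toLinearMap)
    (fun n => by simpa [integralFunctional] using e2 n) f

theorem condExp_eq_integral_biPoissonTransition (hq : -1 < q) (hq' : q < 1) {t u : ℝ≥0}
    (htu : t < u) {g : ℝ → ℝ} (hg : Measurable g) (hgi : Integrable (fun ω => g (X u ω)) P) :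
    P[fun ω => g (X u ω) | pastSigma X t] =ᵐ[P]
      fun ω => ∫ y, g y ∂(biPoissonTransition q η θ t u (X t ω)) := by
  have hid : @Measurable Ω Ω mΩ (pastSigma X t) id := measurable_id'' (pastSigma_le hX.measurable t)
  have e1 := condExp_ae_eq_integral_condDistrib (mβ := pastSigma X t) (X := id) (Y := X u) (μ := P)
    hid (hX.measurable u).aemeasurable hg.stronglyMeasurable hgi
  rw [MeasurableSpace.comap_id] at e1
  filter_upwards [e1, ae_condDistrib_eq hX hmom hq' htu] with ω e2 e3
  rw [e2, ← eq_biPoissonTransition hq hq' e3]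
  rfl

/-- Every neighbourhood of a support point is hit by X_t with positive probability, hence at some ω
whose conditional law is an orthogonality measure. Closedness of the existence set does the rest. -/
lemma exists_isBiPoissonOrthogonality_of_mem_support (hq : -1 < q) (hq' : q < 1) {t u : ℝ≥0}
    (htu : t < u) {x : ℝ} (hx : x ∈ (P.map (X t)).support) :
    ∃ ρ, IsBiPoissonOrthogonality q η θ t u x ρ := by
  refine exists_isBiPoissonOrthogonality_of_mem_closure hq hq' (mem_closure_iff.2 fun U hU hxU => ?_)
  have h1 := (Measure.mem_support_iff_forall x).1 hx U (hU.mem_nhds hxU)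
  rw [Measure.map_apply (hX.measurable t) hU.measurableSet] at h1
  obtain ⟨ω, h2, h3⟩ := ((frequently_ae_iff.2 h1.ne').and_eventually
    (ae_condDistrib_eq hX hmom hq' htu)).exists
  exact ⟨X t ω, h2, _, h3⟩

end regression

/-! ### The infinitesimal generator -/

section generator

variable {q η θ : ℝ} {t : ℝ≥0} {x : ℝ}

lemma tendsto_of_hasDerivAt {φ : ℝ → ℝ} {d : ℝ} (h : HasDerivAt φ d t) :
    Tendsto (fun u : ℝ≥0 => 1 / ((u : ℝ) - t) * (φ u - φ t)) (𝓝[>] t) (𝓝 d) := by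
  have h1 : Tendsto (fun u : ℝ≥0 => (u : ℝ)) (𝓝[>] t) (𝓝[≠] (t : ℝ)) := by
    refine tendsto_nhdsWithin_iff.2 ⟨(NNReal.continuous_coe.tendsto t).mono_left nhdsWithin_le_nhds, ?_⟩
    filter_upwards [self_mem_nhdsWithin] with u hu
    exact (NNReal.coe_lt_coe.2 hu).ne'
  refine (h.tendsto_slope.comp h1).congr fun u => ?_
  simp only [Function.comp, slope_def_field]
  ring

lemma biPoissonGenerator_eval (h : 1 + η * x ≠ 0 → IsBiPoissonOrthogonality q η θ (q ^ 2 * t) t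
      (q * (x - t * η) + θ) (biPoissonTransition q η θ (q ^ 2 * t) t (q * (x - t * η) + θ)))
    (f : ℝ[X]) : biPoissonGenerator q η θ t (fun z => f.eval z) x =
      generatorFunctional q η θ t x f := by
  rw [biPoissonGenerator, generatorFunctional_apply]
  rcases eq_or_ne (1 + η * x) 0 with h0 | h0
  -- If 1 + ηx = 0, both prefactors vanish, whatever value the integral has.
  · rw [h0, zero_mul, zero_mul]
  · simp only [deriv_dslope_eval]
    rw [integral_eval_of_isBiPoissonOrthogonality (h h0)]

lemma integral_eval_sub (f : ℝ[X]) (c : ℝ) {s u : ℝ} {ρ : Measure ℝ}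
    (h : IsBiPoissonOrthogonality q η θ s u x ρ) :
    ∫ y, (f.eval y - c) ∂ρ = (transitionOp q η θ s u f).eval x - c := by
  have := h.isProbabilityMeasure
  rw [integral_sub (integrable_eval h.integrable_pow f) (integrable_const c),
    integral_eval_of_isBiPoissonOrthogonality h, eval_transitionOp]
  simp

end generator

end BiPoisson

theorem mainTheorem7 {Ω : Type*} [MeasurableSpace Ω] (P : Measure Ω) [IsProbabilityMeasure P]
    (q η θ : ℝ) (hq : -1 < q) (hq' : q < 1) (hpar : 0 ≤ q → q < 1 + η * θ)
    (X : ℝ≥0 → Ω → ℝ) (hX : IsStandardQuadraticHarness θ η 0 0 q P X)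
    (hmom : ∀ (t : ℝ≥0) (n : ℕ), Integrable (fun ω => X t ω ^ n) P) :
    -- `X` is a Markov process with transition probabilities `P_{t,u}(x,dy)`
    (∀ t u : ℝ≥0, t < u → ∀ g : ℝ → ℝ, Measurable g → Integrable (fun ω => g (X u ω)) P →
      condExp (pastSigma X t) P (fun ω => g (X u ω)) =ᵐ[P]
        fun ω => ∫ y, g y ∂(biPoissonTransition q η θ t u (X t ω))) ∧
    ∀ t : ℝ≥0, ∀ x ∈ (P.map (X t)).support,
      -- the measures that occur below exist
      (∀ u : ℝ≥0, t < u →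
        IsBiPoissonOrthogonality q η θ t u x (biPoissonTransition q η θ t u x)) ∧
      (1 + η * x ≠ 0 →
        IsBiPoissonOrthogonality q η θ (q ^ 2 * t) t (q * (x - t * η) + θ)
          (biPoissonTransition q η θ (q ^ 2 * t) t (q * (x - t * η) + θ))) ∧
      -- the generator on polynomials in `x`
      (∀ f : Polynomial ℝ,
        Tendsto
          (fun u : ℝ≥0 => 1 / ((u : ℝ) - t) *
            ∫ y, (f.eval y - f.eval x) ∂(biPoissonTransition q η θ t u x))
          (𝓝[>] t) (𝓝 (biPoissonGenerator q η θ t (fun z => f.eval z) x))) ∧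
      -- the generator on polynomials in `(x, t)`
      (∀ f : MvPolynomial (Fin 2) ℝ,
        Tendsto
          (fun u : ℝ≥0 => 1 / ((u : ℝ) - t) *
            ∫ y, (MvPolynomial.eval ![y, (u : ℝ)] f - MvPolynomial.eval ![x, (t : ℝ)] f)
              ∂(biPoissonTransition q η θ t u x))
          (𝓝[>] t)
          (𝓝 (deriv (fun r : ℝ => MvPolynomial.eval ![x, r] f) t +
            biPoissonGenerator q η θ t (fun z => MvPolynomial.eval ![z, (t : ℝ)] f) x))) := by
  refine ⟨fun t u htu g hg hgi =>
    BiPoisson.condExp_eq_integral_biPoissonTransition hX hmom hq hq' htu hg hgi,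
    fun t x hx => ?_⟩
  have h1 : ∀ u : ℝ≥0, t < u → IsBiPoissonOrthogonality q η θ t u x
      (biPoissonTransition q η θ t u x) := fun u htu =>
    BiPoisson.isBiPoissonOrthogonality_biPoissonTransition
      (BiPoisson.exists_isBiPoissonOrthogonality_of_mem_support hX hmom hq hq' htu hx)
  have h2 : 1 + η * x ≠ 0 → IsBiPoissonOrthogonality q η θ (q ^ 2 * t) t (q * (x - t * η) + θ)
      (biPoissonTransition q η θ (q ^ 2 * t) t (q * (x - t * η) + θ)) := fun h0 =>
    BiPoisson.isBiPoissonOrthogonality_biPoissonTransition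
      (BiPoisson.exists_isBiPoissonOrthogonality_generator hq hq' (fun u htu => by
        lift u to ℝ≥0 using t.2.trans htu.le
        exact ⟨_, h1 u (NNReal.coe_lt_coe.1 htu)⟩) h0)
  refine ⟨h1, h2, fun f => ?_, fun f => ?_⟩
  · rw [BiPoisson.biPoissonGenerator_eval h2]
    refine (BiPoisson.tendsto_of_hasDerivAt
      (BiPoisson.hasDerivAt_transitionOp q η θ t x f)).congr' ?_
    filter_upwards [self_mem_nhdsWithin] with u hu
    rw [BiPoisson.integral_eval_sub f _ (h1 u hu), BiPoisson.transitionOp_self]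
  · simp only [← BiPoisson.eval_slice]
    rw [BiPoisson.biPoissonGenerator_eval h2]
    have h3 := BiPoisson.hasDerivAt_transitionOp_slice q η θ t x f
    simp only [← BiPoisson.eval_slice] at h3
    refine (BiPoisson.tendsto_of_hasDerivAt h3).congr' ?_
    filter_upwards [self_mem_nhdsWithin] with u hu
    rw [BiPoisson.integral_eval_sub _ _ (h1 u hu), BiPoisson.transitionOp_self]
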